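/- Let $K$ be a non-archimedean local field with valuation $v$, normalized so that $v$ takes the value $1$ on prime elements, let $n\ge 1$, let $V$ be an $n$-dimensional $K$-vector space with a fixed basis $v_1,\dots,v_n$, and put $\underline n=\{1,\dots,n\}$. Let $G=PGL(V)$ be the group of $K$-rational points, with the topology induced by that of $K$. Let $T\subseteq G$ be the group of classes of matrices that are diagonal with respect to $v_1,\dots,v_n$, and let $N$ be the normalizer of $T$ in $G$; $N$ consists of the classes of products $tw$ of a diagonal matrix $t$ and a permutation matrix $w$ (where $w(v_i)=v_{w(i)}$). *The compactified apartment.* For $\emptyset\ne I\subseteq\underline n$ let $A_I$ be the real vector space generated by elements $\eta_i^I$ $(i\in I)$ subject to $\sum_{i\in I}\eta^I_i=0$; put $A=A_{\underline n}$ and $\eta_i=\eta_i^{\underline n}$, and let $s_I:A\to A_I$ be the linear map with $s_I(\eta_i)=\eta_i^I$ for $i\in I$ and $s_I(\eta_i)=0$ for $i\notin I$. Put $\overline A=\bigsqcup_{\emptyset\neq I\subseteq\underline n}A_I$. A base of the topology of $\overline A$ is given by the open subsets of $A$ together with the sets $\Gamma_U^I=\bigcup_{I\subseteq J\subseteq\underline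 n}s_J\bigl(U+\sum_{i\notin I}\mathbb R_{\ge0}\,\eta_i\bigr)$ for $\emptyset\ne I\subsetneq\underline n$ and $U\subset A$ open and bounded. For $t\in T$ with diagonal entries $d_1,\dots,d_n$ put $\nu(t)=-\sum_i v(d_i)\eta_i\in A$. The group $N$ acts on $\overline A$, by an action also denoted by $\nu$: a permutation matrix $w$ acts by the linear maps $A_I\to A_{w(I)}$, $\eta_i^I\mapsto\eta_{w(i)}^{w(I)}$, and $t\in T$ acts on $A_I$ as the translation by $s_I(\nu(t))$. *The groups $P_x$.* For $i\ne j$ let $a_{ij}$ be the linear form $\sum_k x_k\eta_k\mapsto x_i-x_j$ on $A$, and for $\omega\in K$ let $u_{ij}(\omega)\in G$ be the class of the linear map with $v_j\mapsto v_j+\omega v_i$ and $v_l\mapsto v_l$ for $l\ne j$. For $x\in\overline A$ let $f_x(a_{ij})\in\mathbb R\cup\{\pm\infty\}$ be the infimum of all $t\in\mathbb R$ such that $x$ lies in the closure in $\overline A$ of $\{z\in A: a_{ij}(z)\ge -t\}$. Let $U_x\subseteq G$ be the subgroup generated by all $u_{ij}(\omega)$ with $i\neq j$ and $v(\omega)\ge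 f_x(a_{ij})$ (with $v(0)=\infty$), let $N_x=\{m\in N:\nu(m)x=x\}$, and put $P_x=U_xN_x$. Let $Z=\{t\in T:\nu(t)=0\}$ and $U_0^\wedge=U_0Z$, where $U_0$ is the group $U_x$ for $x=0\in A$. *The compactified building.* On $G\times\overline A$ consider the relation $$(g,x)\sim(h,y)\iff\text{there is } m\in N\text{ with }\nu(m)x=y\text{ and }g^{-1}hm\in P_x .$$ Let $\overline X=(U_0^\wedge\times\overline A)/\!\sim$ be the quotient by the restriction of this relation, with the quotient topology ($U_0^\wedge\subseteq G$ carrying the subspace topology). The action $\mu$ of $G$ on $\overline X$ is defined as follows: if $z\in\overline X$ is induced by $(u,x)$ and $gu=u'\,m\,h$ with $u'\in U_0^\wedge$, $m\in N$, $h\in P_x$, then $\mu(g,z)$ is the point induced by $(u',\nu(m)x)$. **Theorem.** The relation $\sim$ is an equivalence relation on $G\times\overline A$, the rule above gives a well-defined map $\mu:G\times\overline X\to\overline X$, this map is an action of $G$ on $\overline X$, and $\mu$ is continuous. Consequently $\overline X$ is also the quotient of $G\times\overline A$ by $\sim$: the inclusion $U_0^\wedge\times\overline A\hookrightarrow G\times\overline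 A$ induces a homeomorphism $\overline X\to(G\times\overline A)/\!\sim$, where the right-hand side carries the quotient topology. -/

import Mathlib

open scoped Pointwise

namespace BTCompact

noncomputable section

/-! ### The group `PGL(V)` and its topology -/

/-- The group of rational points of `PGL(V)`: the quotient of `GL(V)` by its centre. -/
def PGL (K V : Type*) [Field K] [AddCommGroup V] [Module K V] : Type _ :=
  LinearMap.GeneralLinearGroup K V ⧸ Subgroup.center (LinearMap.GeneralLinearGroup K V)

instance (K V : Type*) [Field K] [AddCommGroup V] [Module K V] : Group (PGL K V) :=
  inferInstanceAs (Group
    (LinearMap.GeneralLinearGroup K V ⧸ Subgroup.center (LinearMap.GeneralLinearGroup K V)))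

/-- The projection `GL(V) → PGL(V)`. -/
def toPGL (K V : Type*) [Field K] [AddCommGroup V] [Module K V] :
    LinearMap.GeneralLinearGroup K V →* PGL K V :=
  QuotientGroup.mk' (Subgroup.center (LinearMap.GeneralLinearGroup K V))

/-- The topology on `GL(V)` induced by the one of `K`: `End(V)` carries its canonical topology as a
finite dimensional vector space (the module topology), and `GL(V) = End(V)ˣ` the topology of a group
of units. -/
@[reducible]
def topGL (K V : Type*) [Field K] [TopologicalSpace K] [AddCommGroup V] [Module K V] :
    TopologicalSpace (LinearMap.GeneralLinearGroup K V) :=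
  @Units.instTopologicalSpaceUnits (Module.End K V) (moduleTopology K (Module.End K V)) _

/-- The quotient topology on `PGL(V)`. -/
instance (K V : Type*) [Field K] [TopologicalSpace K] [AddCommGroup V] [Module K V] :
    TopologicalSpace (PGL K V) :=
  TopologicalSpace.coinduced (toPGL K V) (topGL K V)

section Linear

variable {K : Type*} [Field K] {V : Type*} [AddCommGroup V] [Module K V] {n : ℕ}

/-! ### The torus, its normalizer and the root groups -/

/-- `g ∈ PGL(V)` is the class of the product `t w` of the diagonal matrix with entries `t_i` and the
permutation matrix of `w` (with respect to the basis `b`), i.e. of `v_i ↦ t_{w(i)} v_{w(i)}`. -/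
def IsMonomial (b : Module.Basis (Fin n) K V) (g : PGL K V) (t : Fin n → Kˣ)
    (w : Equiv.Perm (Fin n)) : Prop :=
  ∃ g' : LinearMap.GeneralLinearGroup K V, toPGL K V g' = g ∧
    ∀ i, (g' : Module.End K V) (b i) = (t (w i) : K) • b (w i)

/-- The torus of diagonal elements of `GL(V)` with respect to the basis `b`. -/
def diagGL (b : Module.Basis (Fin n) K V) : Subgroup (LinearMap.GeneralLinearGroup K V) where
  carrier := {g | ∀ i, ∃ d : Kˣ, (g : Module.End K V) (b i) = (d : K) • b i}
  one_mem' i := ⟨1, by simp⟩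
  mul_mem' {g h} hg hh i := by
    obtain ⟨d, hd⟩ := hg i
    obtain ⟨e, he⟩ := hh i
    exact ⟨e * d, by simp [he, hd, smul_smul]⟩
  inv_mem' {g} hg i := by
    obtain ⟨d, hd⟩ := hg i
    refine ⟨d⁻¹, ?_⟩
    have h : ((g⁻¹ : LinearMap.GeneralLinearGroup K V) : Module.End K V)
        ((g : Module.End K V) (b i)) = b i := by
      rw [← Module.End.mul_apply, ← Units.val_mul]; simp
    rw [hd, map_smul] at h
    calc _ = (d⁻¹ : K) • ((d : K) • ((g⁻¹ : LinearMap.GeneralLinearGroup K V) : Module.End K V) (b i)) := by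
            rw [smul_smul]; simp
      _ = _ := by rw [h]; simp

/-- The group `T` of rational points of the maximal torus of `PGL(V)` given by the basis `b`. -/
def torus (b : Module.Basis (Fin n) K V) : Subgroup (PGL K V) := (diagGL b).map (toPGL K V)

/-- The normalizer `N` of `T` in `PGL(V)`. -/
def normT (b : Module.Basis (Fin n) K V) : Subgroup (PGL K V) :=
  Subgroup.normalizer (torus b : Set (PGL K V))

/-- `u ∈ PGL(V)` is the element of the root group `U_a`, `a = a_{ij}`, whose matrix with respect to
`b` has the entry `ω` at the place `(i, j)`. -/
def IsRootElt (b : Module.Basis (Fin n) K V) (i j : Fin n) (ω : K) (u : PGL K V) : Prop :=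
  ∃ u' : LinearMap.GeneralLinearGroup K V, toPGL K V u' = u ∧
    ∀ l, (u' : Module.End K V) (b l) = if l = j then b j + ω • b i else b l

/-- The element `t w` of `GL(V)`, for a diagonal matrix `t` and a permutation `w`. -/
def monoGL (b : Module.Basis (Fin n) K V) (t : Fin n → Kˣ) (w : Equiv.Perm (Fin n)) :
    LinearMap.GeneralLinearGroup K V :=
  LinearMap.GeneralLinearGroup.ofLinearEquiv (b.equiv (b.unitsSMul t) w)

theorem monoGL_apply (b : Module.Basis (Fin n) K V) (t : Fin n → Kˣ) (w : Equiv.Perm (Fin n))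
    (i : Fin n) : (monoGL b t w : Module.End K V) (b i) = (t (w i) : K) • b (w i) := by
  simp [monoGL, Module.Basis.unitsSMul_apply, Units.smul_def]

/-- Elements of the torus act on coordinates by scalars. -/
theorem repr_of_mem_diagGL (b : Module.Basis (Fin n) K V) {g : LinearMap.GeneralLinearGroup K V}
    {d : Fin n → Kˣ} (hd : ∀ i, (g : Module.End K V) (b i) = (d i : K) • b i) (x : V) (j : Fin n) :
    b.repr ((g : Module.End K V) x) j = d j * b.repr x j := by
  have : (b.coord j).comp (g : Module.End K V) = (d j : K) • b.coord j := by
    refine b.ext fun i => ?_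
    by_cases h : i = j
    · subst h; simp [hd]
    · simp [hd, Finsupp.single_eq_of_ne' h]
  simpa using LinearMap.congr_fun this x

/-- If `g t = s g` with `s, t` diagonal and the entries of `t` distinct, then `g` is monomial. -/
theorem monomial_of_conj (b : Module.Basis (Fin n) K V) {g s : LinearMap.GeneralLinearGroup K V}
    {t : Fin n → Kˣ} (ht : Function.Injective t) (hs : s ∈ diagGL b)
    (h : g * monoGL b t 1 = s * g) :
    ∃ (c : Fin n → Kˣ) (w : Equiv.Perm (Fin n)),
      ∀ i, (g : Module.End K V) (b i) = (c (w i) : K) • b (w i) := by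
  choose d hd using hs
  have key : ∀ i j, (t i : K) * b.repr ((g : Module.End K V) (b i)) j =
      d j * b.repr ((g : Module.End K V) (b i)) j := by
    intro i j
    have h1 := congrArg (fun u : LinearMap.GeneralLinearGroup K V =>
      b.repr ((u : Module.End K V) (b i)) j) h
    simp only [Units.val_mul, Module.End.mul_apply, monoGL_apply, Equiv.Perm.one_apply, map_smul,
      repr_of_mem_diagGL b hd, Finsupp.smul_apply, smul_eq_mul] at h1
    exact h1
  have hne : ∀ i, ∃ j, b.repr ((g : Module.End K V) (b i)) j ≠ 0 := by
    intro i
    by_contra! hc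
    have h0 : (g : Module.End K V) (b i) = 0 := by
      apply b.repr.injective
      ext j
      simpa using hc j
    have h2 : ((g⁻¹ : LinearMap.GeneralLinearGroup K V) : Module.End K V)
        ((g : Module.End K V) (b i)) = b i := by
      rw [← Module.End.mul_apply, ← Units.val_mul]; simp
    rw [h0, map_zero] at h2
    exact b.ne_zero i h2.symm
  have huniq : ∀ i i' j, b.repr ((g : Module.End K V) (b i)) j ≠ 0 →
      b.repr ((g : Module.End K V) (b i')) j ≠ 0 → i = i' := by
    intro i i' j h1 h2
    apply ht
    apply Units.ext
    rw [mul_right_cancel₀ h1 (key i j), mul_right_cancel₀ h2 (key i' j)]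
  choose f hf using hne
  have hinj : Function.Injective f := fun i i' hii =>
    huniq i i' (f i) (hf i) (by rw [hii]; exact hf i')
  let w : Equiv.Perm (Fin n) := Equiv.ofBijective f (Finite.injective_iff_bijective.1 hinj)
  have hw : ∀ i, w i = f i := fun i => rfl
  refine ⟨fun j => Units.mk0 (b.repr ((g : Module.End K V) (b (w.symm j))) j) ?_, w, fun i => ?_⟩
  · have := hf (w.symm j)
    rwa [← hw, Equiv.apply_symm_apply] at this
  · apply b.repr.injective
    ext j
    by_cases hj : j = w i
    · subst hj; simp
    · have : b.repr ((g : Module.End K V) (b i)) j = 0 := by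
        by_contra hc
        have h3 := hf (w.symm j)
        rw [← hw, Equiv.apply_symm_apply] at h3
        have := huniq _ _ _ hc h3
        rw [this] at hj
        simp at hj
      rw [this]
      simp [Finsupp.single_eq_of_ne hj]

theorem exists_eq_mul_center {g h : LinearMap.GeneralLinearGroup K V}
    (e : toPGL K V g = toPGL K V h) :
    ∃ c ∈ Subgroup.center (LinearMap.GeneralLinearGroup K V), g = h * c :=
  ⟨h⁻¹ * g, QuotientGroup.eq.1 e.symm, by simp⟩

end Linear

/-! ### The normalized valuation -/

/-- The valuation `v` of a non-archimedean local field, normalized to take the value `1` on prime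
elements; the value at `0` is irrelevant. -/
def val {K : Type*} [Field K] [ValuativeRel K] [TopologicalSpace K] [IsNonarchimedeanLocalField K]
    (x : K) : ℤ :=
  -WithZero.log (IsNonarchimedeanLocalField.valueGroupWithZeroIsoInt K
    (ValuativeRel.valuation K x))

/-- The normalized valuation with `v(0) = ∞`, as an extended real number. -/
def valE {K : Type*} [Field K] [ValuativeRel K] [TopologicalSpace K] [IsNonarchimedeanLocalField K]
    (x : K) : EReal :=
  open scoped Classical in if x = 0 then ⊤ else (((val x : ℤ) : ℝ) : EReal)

/-! ### The apartment and its compactification -/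

/-- The apartment `A`: the real vector space generated by `η_1, …, η_n` subject to the relation
`η_1 + ⋯ + η_n = 0`. -/
abbrev Apt (n : ℕ) : Type := (Fin n → ℝ) ⧸ Submodule.span ℝ {(1 : Fin n → ℝ)}

/-- The piece `A_I`: the real vector space generated by `η_i^I` for `i ∈ I`, subject to the relation
`∑_{i ∈ I} η_i^I = 0`. -/
abbrev AptI {n : ℕ} (I : Finset (Fin n)) : Type := (I → ℝ) ⧸ Submodule.span ℝ {(1 : I → ℝ)}

/-- The generator `η_i` of `A`. -/
def eta {n : ℕ} (i : Fin n) : Apt n := Submodule.Quotient.mk (Pi.single i 1)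

/-- The root `a_{ij} = χ_i / χ_j`, as a linear form on `A`: `∑ x_k η_k ↦ x_i - x_j`. -/
def root {n : ℕ} (i j : Fin n) : Apt n →ₗ[ℝ] ℝ :=
  Submodule.liftQ _ ((LinearMap.proj i : (Fin n → ℝ) →ₗ[ℝ] ℝ) - LinearMap.proj j) (by
    rw [Submodule.span_singleton_le_iff_mem, LinearMap.mem_ker]; simp [LinearMap.sub_apply])

/-- The projection `s_I : A → A_I`, which maps `η_i` to `η_i^I` if `i ∈ I` and to `0` otherwise. -/
def sMap {n : ℕ} (I : Finset (Fin n)) : Apt n →ₗ[ℝ] AptI I :=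
  Submodule.mapQ _ _ (LinearMap.funLeft ℝ ℝ (Subtype.val : I → Fin n)) (by
    rw [Submodule.span_singleton_le_iff_mem]
    exact Submodule.mem_span_singleton_self _)

/-- The compactification of the apartment, as a set: the disjoint union of the `A_I` over the
non-empty subsets `I` of `{1, …, n}`. The piece `A_{1, …, n}` is `A`. -/
@[ext]
structure Abar (n : ℕ) where
  I : Finset (Fin n)
  nonempty : I.Nonempty
  pt : AptI I

/-- The inclusion of `A` as the piece with `I = {1, …, n}`. -/
def incl {n : ℕ} [NeZero n] (z : Apt n) : Abar n :=
  ⟨Finset.univ, Finset.univ_nonempty, sMap Finset.univ z⟩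

/-- The cone `Δ_I = ∑_{i ∉ I} ℝ_{≥ 0} η_i`. -/
def Delta {n : ℕ} (I : Finset (Fin n)) : Set (Apt n) :=
  {z | ∃ c : Fin n → ℝ, (∀ i, 0 ≤ c i) ∧ z = ∑ i ∈ Iᶜ, c i • eta i}

/-- The set `Γ_U^I`: the union of the sets `s_J (U + Δ_I)` for all `J ⊇ I`, where `J = {1, …, n}`
contributes `U + Δ_I` itself. -/
def Gam {n : ℕ} (U : Set (Apt n)) (I : Finset (Fin n)) : Set (Abar n) :=
  {p | I ⊆ p.I ∧ ∃ z ∈ U + Delta I, sMap p.I z = p.pt}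

/-- The topology on the compactified apartment, generated by the open subsets of `A` and the sets
`Γ_U^I` for non-empty proper `I` and open bounded `U`. -/
instance (n : ℕ) [NeZero n] : TopologicalSpace (Abar n) :=
  TopologicalSpace.generateFrom
    ({S | ∃ U : Set (Apt n), IsOpen U ∧ S = incl '' U} ∪
     {S | ∃ (U : Set (Apt n)) (I : Finset (Fin n)), IsOpen U ∧ Bornology.IsBounded U ∧
        I.Nonempty ∧ I ≠ Finset.univ ∧ S = Gam U I})

/-- The bijection `w : A_I → A_{w(I)}` induced by a permutation `w`, which maps `η_i^I` to
`η_{w(i)}^{w(I)}`. -/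
def permMap {n : ℕ} (w : Equiv.Perm (Fin n)) (I : Finset (Fin n)) :
    AptI I →ₗ[ℝ] AptI (I.map w.toEmbedding) :=
  Submodule.mapQ _ _
    (LinearMap.funLeft ℝ ℝ (fun j : I.map w.toEmbedding =>
      (⟨w.symm j, by
        obtain ⟨i, hi, hij⟩ := Finset.mem_map.1 j.2
        simpa [← hij] using hi⟩ : I)))
    (by
      rw [Submodule.span_singleton_le_iff_mem]
      exact Submodule.mem_span_singleton_self _)

section Valued

variable {K : Type*} [Field K] [ValuativeRel K] [TopologicalSpace K] [IsNonarchimedeanLocalField K]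
variable {V : Type*} [AddCommGroup V] [Module K V] {n : ℕ}

/-- The translation vector `ν(t) = ∑ -v(t_i) η_i ∈ A` of the diagonal matrix with entries `t_i`. -/
def nuT (t : Fin n → Kˣ) : Apt n := ∑ i, (-((val (t i : K) : ℤ) : ℝ)) • eta i

/-- The map on the compactified apartment given by the permutation `w`, followed on each piece `A_J`
by the translation by `s_J (ν(t))`. -/
def affMap (t : Fin n → Kˣ) (w : Equiv.Perm (Fin n)) (p : Abar n) : Abar n :=
  ⟨p.I.map w.toEmbedding, p.nonempty.map,
    permMap w p.I p.pt + sMap (p.I.map w.toEmbedding) (nuT t)⟩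

/-! ### The action of the normalizer on the compactified apartment -/

theorem exists_injective_units (K : Type*) [Field K] [ValuativeRel K] [TopologicalSpace K]
    [IsNonarchimedeanLocalField K] (n : ℕ) : ∃ t : Fin n → Kˣ, Function.Injective t := by
  obtain ⟨x, hx0, hx1⟩ := Valuation.IsNontrivial.exists_lt_one (v := ValuativeRel.valuation K)
  have hx : x ≠ 0 := by rintro rfl; simp at hx0
  refine ⟨fun i => (Units.mk0 x hx) ^ (i : ℕ), fun i j hij => ?_⟩
  have h := congrArg (fun u : Kˣ => ValuativeRel.valuation K (u : K)) hij
  simp only [Units.val_pow_eq_pow_val, Units.val_mk0, map_pow] at h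
  exact Fin.ext ((pow_right_strictAnti₀ (zero_lt_iff.2 ((map_ne_zero _).2 hx)) hx1).injective h)

/-- The centre of `GL(V)` consists of scalars. -/
theorem exists_scalar_of_mem_center (b : Module.Basis (Fin n) K V)
    {c : LinearMap.GeneralLinearGroup K V}
    (hc : c ∈ Subgroup.center (LinearMap.GeneralLinearGroup K V)) :
    ∃ l : Kˣ, ∀ x, (c : Module.End K V) x = (l : K) • x := by
  obtain ⟨t, ht⟩ := exists_injective_units K n
  have hcomm : ∀ (s : Fin n → Kˣ) (w : Equiv.Perm (Fin n)) (x : V),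
      (c : Module.End K V) ((monoGL b s w : Module.End K V) x) =
        (monoGL b s w : Module.End K V) ((c : Module.End K V) x) := by
    intro s w x
    rw [← Module.End.mul_apply, ← Module.End.mul_apply, ← Units.val_mul, ← Units.val_mul,
      Subgroup.mem_center_iff.1 hc]
  obtain ⟨e, w, hw⟩ := monomial_of_conj b ht (g := c) (s := monoGL b t 1)
    (fun i => ⟨t i, by simp [monoGL_apply]⟩) (Subgroup.mem_center_iff.1 hc _).symm
  have hw1 : ∀ i, w i = i := by
    intro i
    have h1 := hcomm t 1 (b i)
    rw [monoGL_apply, map_smul, Equiv.Perm.one_apply, hw, map_smul, monoGL_apply, smul_smul,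
      smul_smul, mul_comm, Equiv.Perm.one_apply] at h1
    have h2 := smul_left_injective K (b.ne_zero (w i)) h1
    have h3 := mul_left_cancel₀ (Units.ne_zero _) h2
    exact ht (Units.ext h3.symm)
  rcases isEmpty_or_nonempty (Fin n) with hn | ⟨⟨i₀⟩⟩
  · refine ⟨1, fun x => ?_⟩
    have : (c : Module.End K V) = 1 := b.ext fun i => hn.elim i
    simp [this]
  · refine ⟨e i₀, fun x => ?_⟩
    have : (c : Module.End K V) = (e i₀ : K) • (1 : Module.End K V) := by
      refine b.ext fun i => ?_
      have h1 := hcomm 1 (Equiv.swap i₀ i) (b i₀)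
      rw [monoGL_apply, map_smul, hw, hw, map_smul, hw1 i₀, monoGL_apply] at h1
      simp only [Equiv.swap_apply_left, Pi.one_apply, Units.val_one, one_smul, hw1] at h1
      rw [hw, hw1]
      simpa using h1
    simp [this]

theorem exists_isMonomial (b : Module.Basis (Fin n) K V) (g : normT b) :
    ∃ (t : Fin n → Kˣ) (w : Equiv.Perm (Fin n)), IsMonomial b g.1 t w := by
  obtain ⟨t, ht⟩ := exists_injective_units K n
  obtain ⟨g', hg'⟩ := QuotientGroup.mk'_surjective
    (Subgroup.center (LinearMap.GeneralLinearGroup K V)) g.1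
  change toPGL K V g' = g.1 at hg'
  have hmem : toPGL K V (monoGL b t 1) ∈ (torus b : Set (PGL K V)) :=
    ⟨monoGL b t 1, fun i => ⟨t i, by simp [monoGL_apply]⟩, rfl⟩
  obtain ⟨s, hs, hs'⟩ := (Subgroup.mem_set_normalizer_iff.1 g.2 _).1 hmem
  rw [← hg', ← map_inv, ← map_mul, ← map_mul] at hs'
  obtain ⟨c, hc, hcs⟩ := exists_eq_mul_center hs'.symm
  obtain ⟨l, hl⟩ := exists_scalar_of_mem_center b hc
  have hcd : c ∈ diagGL b := fun i => ⟨l, hl _⟩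
  obtain ⟨e, w, hw⟩ := monomial_of_conj b ht ((diagGL b).mul_mem hs hcd)
    (mul_inv_eq_iff_eq_mul.1 hcs)
  exact ⟨e, w, g', hg', hw⟩

theorem val_mul_units (x y : Kˣ) : val ((x * y : Kˣ) : K) = val (x : K) + val (y : K) := by
  have h : ∀ z : Kˣ, IsNonarchimedeanLocalField.valueGroupWithZeroIsoInt K
      (ValuativeRel.valuation K (z : K)) ≠ 0 := by
    intro z
    rw [map_ne_zero_iff _ (EquivLike.injective _)]
    exact (map_ne_zero _).2 z.ne_zero
  simp only [val, Units.val_mul, map_mul]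
  rw [WithZero.log_mul (h x) (h y)]
  ring

theorem sum_eta (n : ℕ) : ∑ i, (eta i : Apt n) = 0 := by
  have h : ∑ i, (eta i : Apt n) =
      Submodule.mkQ (Submodule.span ℝ {(1 : Fin n → ℝ)}) (∑ i, Pi.single i (1 : ℝ)) := by
    rw [map_sum]; rfl
  have h1 : ∑ i, Pi.single i (1 : ℝ) = (1 : Fin n → ℝ) :=
    Finset.univ_sum_single (1 : Fin n → ℝ)
  rw [h, h1]
  exact (Submodule.Quotient.mk_eq_zero _).2 (Submodule.mem_span_singleton_self _)

theorem IsMonomial.unique (b : Module.Basis (Fin n) K V) {g : PGL K V} {t t' : Fin n → Kˣ}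
    {w w' : Equiv.Perm (Fin n)} (h : IsMonomial b g t w) (h' : IsMonomial b g t' w') :
    w = w' ∧ nuT t = nuT t' := by
  obtain ⟨g1, hg1, h1⟩ := h
  obtain ⟨g2, hg2, h2⟩ := h'
  obtain ⟨c, hc, hcs⟩ := exists_eq_mul_center (hg1.trans hg2.symm)
  obtain ⟨l, hl⟩ := exists_scalar_of_mem_center b hc
  have key : ∀ i, (t (w i) : K) • b (w i) = ((l * t' (w' i) : Kˣ) : K) • b (w' i) := by
    intro i
    rw [← h1, hcs, Units.val_mul, Module.End.mul_apply, hl, map_smul, h2, smul_smul, Units.val_mul]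
  have hw : w = w' := by
    ext1 i
    by_contra hne
    have h3 := congrArg (fun x => b.repr x (w i)) (key i)
    simp [Finsupp.single_eq_of_ne hne] at h3
  subst hw
  refine ⟨rfl, ?_⟩
  have ht : ∀ i, t i = l * t' i := by
    intro i
    have h3 := smul_left_injective K (b.ne_zero _) (key (w.symm i))
    exact Units.ext (by simpa using h3)
  have : nuT t = nuT t' + (-((val (l : K) : ℤ) : ℝ)) • ∑ i, (eta i : Apt n) := by
    simp only [nuT, ht, val_mul_units, Finset.smul_sum, ← Finset.sum_add_distrib, ← add_smul]
    refine Finset.sum_congr rfl fun i _ => ?_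
    congr 1
    push_cast
    ring
  rw [this, sum_eta, smul_zero, add_zero]

/-- The action `ν` of `N` on the compactified apartment: the class of `t w` acts by the permutation
`w` followed by the translation by the `s_J (ν(t))`. It does not depend on the choice of `t` and `w`
by `nu_eq`. -/
def nu (b : Module.Basis (Fin n) K V) (g : normT b) (p : Abar n) : Abar n :=
  affMap (exists_isMonomial b g).choose (exists_isMonomial b g).choose_spec.choose p

theorem nu_eq (b : Module.Basis (Fin n) K V) (g : normT b) (p : Abar n) (t : Fin n → Kˣ)
    (w : Equiv.Perm (Fin n)) (h : IsMonomial b g.1 t w) : nu b g p = affMap t w p := by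
  obtain ⟨hw, ht⟩ := IsMonomial.unique b (exists_isMonomial b g).choose_spec.choose_spec h
  unfold nu affMap
  rw [ht, hw]

/-! ### The groups `U_x` and the groups `P_x` -/

/-- The number `f_x(a_{ij}) = inf {t ∈ ℝ | x lies in the closure of {z ∈ A | a_{ij}(z) ≥ -t}}`. -/
def fval [NeZero n] (x : Abar n) (i j : Fin n) : EReal :=
  sInf ((fun t : ℝ => (t : EReal)) '' {t | x ∈ closure (incl '' {z | -t ≤ root i j z})})

/-- The group `U_x`, generated by the groups `U_{a,x} = {u ∈ U_a | ψ_a(u) ≥ f_x(a)}` for all roots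
`a`. -/
def Ux [NeZero n] (b : Module.Basis (Fin n) K V) (x : Abar n) : Subgroup (PGL K V) :=
  Subgroup.closure {u | ∃ (i j : Fin n) (ω : K), i ≠ j ∧ fval x i j ≤ valE ω ∧ IsRootElt b i j ω u}

/-- `P_x = U_x N_x`, where `N_x` is the stabilizer of `x` in `N`. -/
def Px [NeZero n] (b : Module.Basis (Fin n) K V) (x : Abar n) : Set (PGL K V) :=
  {g | ∃ u ∈ Ux b x, ∃ m : normT b, nu b m x = x ∧ g = u * m}

/-- `U_0^∧ = U_0 Z`, where `Z` is the kernel of `ν : T → A`. -/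
def U0hat [NeZero n] (b : Module.Basis (Fin n) K V) : Set (PGL K V) :=
  {g | ∃ u ∈ Ux b (incl 0), ∃ (z : PGL K V) (t : Fin n → Kˣ),
    IsMonomial b z t 1 ∧ nuT t = 0 ∧ g = u * z}

/-! ### The compactified building -/

/-- The relation `(g, x) ∼ (h, y)` on `G × A̅`: there is an `n ∈ N` with `ν(n) x = y` and
`g⁻¹ h n ∈ P_x`. -/
def Rel [NeZero n] (b : Module.Basis (Fin n) K V) (p q : PGL K V × Abar n) : Prop :=
  ∃ m : normT b, nu b m p.2 = q.2 ∧ p.1⁻¹ * q.1 * m ∈ Px b p.2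

/-- The restriction of the relation to `U_0^∧ × A̅`. -/
def Rel0 [NeZero n] (b : Module.Basis (Fin n) K V) (p q : U0hat b × Abar n) : Prop :=
  Rel b (p.1.1, p.2) (q.1.1, q.2)

/-- The compactification `X̅` of the building: the quotient of `U_0^∧ × A̅` by `∼`, with the
quotient topology. -/
abbrev Xbar [NeZero n] (b : Module.Basis (Fin n) K V) : Type _ := Quot (Rel0 b)

/-- The point of `X̅` induced by `(u, x) ∈ U_0^∧ × A̅`. -/
def toXbar [NeZero n] (b : Module.Basis (Fin n) K V) (u : U0hat b) (x : Abar n) : Xbar b :=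
  Quot.mk _ (u, x)

/-- The defining property of `μ(g, z) = z'`: the point `z` is induced by some `(u, x)` and `z'` by
`(v, ν(n) x)`, where `g u = v n h` with `v ∈ U_0^∧`, `n ∈ N` and `h ∈ P_x`. -/
def MuGraph [NeZero n] (b : Module.Basis (Fin n) K V) (g : PGL K V) (z z' : Xbar b) : Prop :=
  ∃ (u : U0hat b) (x : Abar n) (v : U0hat b) (m : normT b) (h : PGL K V),
    h ∈ Px b x ∧ g * u.1 = v.1 * m * h ∧ z = toXbar b u x ∧ z' = toXbar b v (nu b m x)

/-- The action map `μ : G × X̅ → X̅`. -/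
def mu [NeZero n] (b : Module.Basis (Fin n) K V) (g : PGL K V) (z : Xbar b) : Xbar b :=
  open scoped Classical in if h : ∃ z', MuGraph b g z z' then h.choose else z

end Valued

end

end BTCompact

open scoped Pointwise NNReal
open Filter Topology

set_option linter.unusedSectionVars false

namespace BTCompact

noncomputable section

/-! ### The absolute value and the topology of the field -/

section AbsoluteValue

variable {K : Type*} [Field K] [ValuativeRel K] [TopologicalSpace K] [IsNonarchimedeanLocalField K]

/-! A point of the compactified apartment is a homothety class of non-zero weights `c` in `ℝ≥0^n`:
the point `∑ x_i η_i^I` has weights `e^{-x_i}` on `I` and `0` outside `I`. Weights define the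
seminorm `sn c`, `v ↦ max |v_i| c_i`, on `K^n`, and a pair `(g, x)` defines the homothety class of
`v ↦ sn c (g⁻¹ v)`. The heart of the proof is that `(g, x) ∼ (h, y)` if and only if these classes
agree (`rel_Phi_iff`), `P_x` being the stabilizer of the class of `x` (`Phi_mem_Px_iff`). Hence `∼`
is an equivalence relation, invariant under left translation.

The algebra rests on a weighted Gaussian elimination (`exists_elem_mul_mul_eq_monoMat`): for any
weights `c` and `d`, an invertible matrix becomes monomial after multiplication by elementary
matrices that preserve `sn d` on the left and `sn c` on the right. By `fval_le_valE_iff`, the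
condition `v(ω) ≥ f_x(a_ij)` means `|ω| c_i ≤ c_j`, so these elementary groups map onto the groups
`U_x`. Taking the weights of `x` on both sides describes `P_x`, the weights of `x` and `y` describe
`∼`, and the weights `1` on the left give `G = U_0^∧ N P_x` (`exists_mul_mul`), so that `μ` is
defined everywhere.

For the topology, seminorms are divided by their maximum on the standard basis. The resulting map
`sem` on `G × A̅` is continuous and its fibres are the classes of `∼`. Both `U_0^∧` (the image of
`GL_n` of the integers) and `A̅` (the image of the weights with maximum `1`) are compact, so `semX`
is a closed embedding of `X̅` into a space of functions (`isClosedEmbedding_semX`). In terms of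
seminorms `μ(g, [u, x])` is `sem (g u) x`, and all claims about `μ` are checked there. The inverse
of the final homeomorphism is `(g, x) ↦ μ(g, [1, x])`. -/

theorem one_lt_expNNReal : (1 : ℝ≥0) < Real.toNNReal (Real.exp 1) := by
  rw [Real.one_lt_toNNReal]
  simp

/-- The absolute value `x ↦ e^{-v(x)}` of a non-archimedean local field. -/
def absK : K →*₀ ℝ≥0 where
  toFun x := WithZeroMulInt.toNNReal one_lt_expNNReal.ne_zero
    (IsNonarchimedeanLocalField.valueGroupWithZeroIsoInt K (ValuativeRel.valuation K x))
  map_zero' := by simp only [map_zero]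
  map_one' := by simp only [map_one]
  map_mul' x y := by simp only [map_mul]

theorem absK_apply (x : K) : absK x = WithZeroMulInt.toNNReal one_lt_expNNReal.ne_zero
    (IsNonarchimedeanLocalField.valueGroupWithZeroIsoInt K (ValuativeRel.valuation K x)) := rfl

theorem absK_le_iff (x y : K) :
    absK x ≤ absK y ↔ ValuativeRel.valuation K x ≤ ValuativeRel.valuation K y := by
  rw [absK_apply, absK_apply, (WithZeroMulInt.toNNReal_strictMono one_lt_expNNReal).le_iff_le]
  exact map_le_map_iff (IsNonarchimedeanLocalField.valueGroupWithZeroIsoInt K)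

theorem absK_add_le (x y : K) : absK (x + y) ≤ max (absK x) (absK y) := by
  rcases le_total (absK x) (absK y) with h | h
  · rw [max_eq_right h]
    rw [absK_le_iff] at h ⊢
    exact (ValuativeRel.valuation K).map_add_le h le_rfl
  · rw [max_eq_left h]
    rw [absK_le_iff] at h ⊢
    exact (ValuativeRel.valuation K).map_add_le le_rfl h

theorem absK_neg (x : K) : absK (-x) = absK x :=
  le_antisymm ((absK_le_iff _ _).2 (by rw [Valuation.map_neg]))
    ((absK_le_iff _ _).2 (by rw [Valuation.map_neg]))

theorem absK_eq_exp {x : K} (hx : x ≠ 0) : (absK x : ℝ) = Real.exp (-(val x : ℝ)) := by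
  have h : IsNonarchimedeanLocalField.valueGroupWithZeroIsoInt K
      (ValuativeRel.valuation K x) ≠ 0 := by
    rw [map_ne_zero_iff _ (EquivLike.injective _)]
    exact (map_ne_zero _).2 hx
  rw [absK_apply, WithZeroMulInt.toNNReal_neg_apply _ h, val]
  have h2 : WithZero.log (IsNonarchimedeanLocalField.valueGroupWithZeroIsoInt K
      (ValuativeRel.valuation K x)) = (WithZero.unzero h).toAdd := by
    conv_lhs => rw [← WithZero.coe_unzero h]
    rfl
  rw [h2, NNReal.coe_zpow, ← Real.rpow_intCast, Real.coe_toNNReal _ (Real.exp_pos 1).le, Real.exp_one_rpow]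
  push_cast
  rw [neg_neg]

theorem absK_sum_le {ι : Type*} (s : Finset ι) (f : ι → K) :
    absK (∑ i ∈ s, f i) ≤ s.sup fun i => absK (f i) := by
  classical
  induction s using Finset.induction_on with
  | empty => simp
  | insert a s ha ih =>
    rw [Finset.sum_insert ha, Finset.sup_insert]
    exact (absK_add_le _ _).trans (sup_le_sup_left ih _)

theorem eventually_absK_lt {ε : ℝ≥0} (hε : 0 < ε) : ∀ᶠ x : K in 𝓝 0, absK x < ε := by
  obtain ⟨x, hx0, hx1⟩ := Valuation.IsNontrivial.exists_lt_one (v := ValuativeRel.valuation K)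
  have hx : x ≠ 0 := by rintro rfl; simp at hx0
  have hlt : absK x < 1 := by
    rw [← not_le, ← map_one (absK (K := K)), absK_le_iff, map_one, not_le]
    exact hx1
  obtain ⟨k, hk⟩ := exists_pow_lt_of_lt_one hε hlt
  have hmem := (IsValuativeTopology.hasBasis_nhds_zero' K).mem_of_mem
    (i := ValuativeRel.valuation K (x ^ k)) ((map_ne_zero _).2 (pow_ne_zero _ hx))
  filter_upwards [hmem] with y hy
  rw [← map_pow] at hk
  exact lt_of_le_of_lt ((absK_le_iff _ _).2 (le_of_lt hy)) hk

theorem continuous_absK : Continuous (absK : K → ℝ≥0) := by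
  rw [continuous_iff_continuousAt]
  intro a
  rw [ContinuousAt, Metric.tendsto_nhds]
  intro ε hε
  have h1 : Tendsto (fun x : K => x - a) (𝓝 a) (𝓝 0) := by
    have : Continuous fun x : K => x - a := by fun_prop
    simpa using this.tendsto a
  filter_upwards [h1.eventually (eventually_absK_lt (ε := ⟨ε, hε.le⟩) hε)] with x hx
  have e1 : absK x ≤ absK (x - a) + absK a := by
    calc absK x = absK (x - a + a) := by simp
      _ ≤ _ := (absK_add_le _ _).trans (max_le_add_of_nonneg zero_le zero_le)
  have e2 : absK a ≤ absK (x - a) + absK x := by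
    calc absK a = absK (-(x - a) + x) := by simp
      _ ≤ _ := (absK_add_le _ _).trans (max_le_add_of_nonneg zero_le zero_le)
      _ = _ := by rw [absK_neg]
  have hx' : (absK (x - a) : ℝ) < ε := hx
  have e1' : (absK x : ℝ) ≤ absK (x - a) + absK a := by exact_mod_cast e1
  have e2' : (absK a : ℝ) ≤ absK (x - a) + absK x := by exact_mod_cast e2
  rw [NNReal.dist_eq, abs_lt]
  constructor <;> linarith

theorem absK_ne_zero {x : K} : absK x ≠ 0 ↔ x ≠ 0 := map_ne_zero _

instance t2Space_localField : T2Space K := by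
  refine ⟨fun x y hxy => ?_⟩
  have h : absK (x - x) ≠ absK (y - x) := by
    rw [sub_self, map_zero]
    exact (absK_ne_zero.2 (sub_ne_zero.2 hxy.symm)).symm
  exact separated_by_continuous (f := fun z => absK (z - x))
    (continuous_absK.comp (by fun_prop)) h

end AbsoluteValue

/-! ### Weighted maximum seminorms -/

section Seminorm

variable {K : Type*} [Field K] [ValuativeRel K] [TopologicalSpace K] [IsNonarchimedeanLocalField K]
variable {n : ℕ}

/-- The seminorm on `K^n` with weights `c_i` on the standard basis. -/
def sn (c : Fin n → ℝ≥0) (x : Fin n → K) : ℝ≥0 := Finset.univ.sup fun i => absK (x i) * c i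

theorem le_sn (c : Fin n → ℝ≥0) (x : Fin n → K) (i : Fin n) : absK (x i) * c i ≤ sn c x :=
  Finset.le_sup (f := fun i => absK (x i) * c i) (Finset.mem_univ i)

theorem sn_le_iff {c : Fin n → ℝ≥0} {x : Fin n → K} {r : ℝ≥0} :
    sn c x ≤ r ↔ ∀ i, absK (x i) * c i ≤ r := by
  simp [sn]

theorem sn_single (c : Fin n → ℝ≥0) (i : Fin n) : sn c (Pi.single i (1 : K)) = c i := by
  refine le_antisymm (sn_le_iff.2 fun j => ?_) ?_
  · by_cases h : j = i
    · subst h; simp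
    · simp [h]
  · simpa using le_sn c (Pi.single i (1 : K)) i

theorem sn_smul (r : ℝ≥0) (c : Fin n → ℝ≥0) (x : Fin n → K) :
    sn (fun i => r * c i) x = r * sn c x := by
  simp only [sn, NNReal.mul_finset_sup]
  congr 1
  ext i
  ring_nf

theorem sn_scalar (c : Fin n → ℝ≥0) (l : K) (x : Fin n → K) : sn c (l • x) = absK l * sn c x := by
  simp only [sn, NNReal.mul_finset_sup, Pi.smul_apply, smul_eq_mul, map_mul, mul_assoc]

theorem continuous_sn : Continuous fun p : (Fin n → ℝ≥0) × (Fin n → K) => sn p.1 p.2 := by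
  have h : (fun p : (Fin n → ℝ≥0) × (Fin n → K) => sn p.1 p.2) =
      Finset.univ.sup fun (i : Fin n) (p : (Fin n → ℝ≥0) × (Fin n → K)) => absK (p.2 i) * p.1 i := by
    ext p
    simp [sn, Finset.sup_apply]
  rw [h]
  refine Continuous.finset_sup fun i _ => ?_
  exact (continuous_absK.comp (by fun_prop)).mul (by fun_prop)

end Seminorm

/-! ### Gaussian elimination with weighted pivots -/

section Elimination

open Matrix

variable {K : Type*} [Field K] {n : ℕ}

/-- The transvection `1 + a f`, for a column `a` and a row `f` with `f a = 0`. -/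
def shear (a f : Fin n → K) (h : f ⬝ᵥ a = 0) : GL (Fin n) K where
  val := 1 + vecMulVec a f
  inv := 1 - vecMulVec a f
  val_inv := by
    rw [add_mul, mul_sub, mul_sub, vecMulVec_mul_vecMulVec, h]; simp
  inv_val := by
    rw [sub_mul, mul_add, mul_add, vecMulVec_mul_vecMulVec, h]; simp

theorem shear_mul_left {a a' f : Fin n → K} (h : f ⬝ᵥ a = 0) (h' : f ⬝ᵥ a' = 0)
    (h'' : f ⬝ᵥ (a + a') = 0) : shear a f h * shear a' f h' = shear (a + a') f h'' := by
  apply Units.ext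
  simp only [Units.val_mul, shear]
  rw [add_mul, mul_add, mul_add, vecMulVec_mul_vecMulVec, h', add_vecMulVec]
  simp only [one_mul, mul_one, zero_smul, vecMulVec_zero]
  abel

theorem shear_mul_right {a f f' : Fin n → K} (h : f ⬝ᵥ a = 0) (h' : f' ⬝ᵥ a = 0)
    (h'' : (f + f') ⬝ᵥ a = 0) : shear a f h * shear a f' h' = shear a (f + f') h'' := by
  apply Units.ext
  simp only [Units.val_mul, shear]
  rw [add_mul, mul_add, mul_add, vecMulVec_mul_vecMulVec, h, vecMulVec_add]
  simp only [one_mul, mul_one, zero_smul, vecMulVec_zero]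
  abel

theorem shear_eq_one {a f : Fin n → K} (h : f ⬝ᵥ a = 0) (h0 : vecMulVec a f = 0) :
    shear a f h = 1 := by
  apply Units.ext
  simp [shear, h0]

theorem transvection_eq_vecMulVec (i j : Fin n) (ω : K) :
    transvection i j ω = 1 + vecMulVec (Pi.single i ω) (Pi.single j 1) := by
  ext k l
  simp only [transvection, Matrix.add_apply, vecMulVec_apply, Matrix.single_apply, Pi.single_apply]
  congr 1
  split_ifs <;> simp_all

theorem sum_single_apply_of_notMem {s : Finset (Fin n)} (a : Fin n → K) {p : Fin n} (hp : p ∉ s) :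
    (∑ i ∈ s, Pi.single i (a i) : Fin n → K) p = 0 := by
  rw [Finset.sum_apply]
  exact Finset.sum_eq_zero fun i hi => Pi.single_eq_of_ne (by rintro rfl; exact hp hi) _

/-- For a fixed row vector, shears multiply by adding their columns, so the shear is a product of
transvections, split off one entry at a time. -/
theorem shear_col_mem (H : Subgroup (GL (Fin n) K)) {p : Fin n} {a : Fin n → K} (ha : a p = 0)
    (hH : ∀ i (_ : i ≠ p), ∀ g : GL (Fin n) K, g.1 = transvection i p (a i) → g ∈ H)
    (h : Pi.single p 1 ⬝ᵥ a = 0) : shear a (Pi.single p 1) h ∈ H := by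
  have key : ∀ s : Finset (Fin n), p ∉ s →
      ∀ h' : Pi.single p 1 ⬝ᵥ (∑ i ∈ s, Pi.single i (a i)) = 0,
        shear (∑ i ∈ s, Pi.single i (a i)) (Pi.single p 1) h' ∈ H := by
    intro s
    induction s using Finset.induction_on with
    | empty =>
      intro _ h'
      rw [shear_eq_one _ (by simp)]
      exact H.one_mem
    | insert k s hk ih =>
      intro hp h'
      rw [Finset.mem_insert, not_or] at hp
      have h1 : Pi.single p 1 ⬝ᵥ (Pi.single k (a k) : Fin n → K) = 0 := by
        simp [hp.1]
      have h2 : Pi.single p 1 ⬝ᵥ (∑ i ∈ s, Pi.single i (a i) : Fin n → K) = 0 := by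
        rw [single_one_dotProduct, sum_single_apply_of_notMem a hp.2]
      have h3 := shear_mul_left h1 h2 (by rw [dotProduct_add, h1, h2, add_zero])
      simp only [Finset.sum_insert hk] at h' ⊢
      rw [← h3]
      exact H.mul_mem (hH k (Ne.symm hp.1) _ (transvection_eq_vecMulVec _ _ _).symm) (ih hp.2 h2)
  have ha' : (∑ i ∈ Finset.univ.erase p, Pi.single i (a i) : Fin n → K) = a := by
    conv_rhs => rw [← Finset.univ_sum_single a]
    rw [← Finset.add_sum_erase _ _ (Finset.mem_univ p), ha]
    simp
  have := key (Finset.univ.erase p) (by simp) (by rw [ha']; exact h)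
  simpa only [ha'] using this

theorem shear_row_mem (H : Subgroup (GL (Fin n) K)) {q : Fin n} {f : Fin n → K} (hf : f q = 0)
    (hH : ∀ j (_ : j ≠ q), ∀ g : GL (Fin n) K, g.1 = transvection q j (f j) → g ∈ H)
    (h : f ⬝ᵥ Pi.single q 1 = 0) : shear (Pi.single q 1) f h ∈ H := by
  have key : ∀ s : Finset (Fin n), q ∉ s →
      ∀ h' : (∑ i ∈ s, Pi.single i (f i)) ⬝ᵥ Pi.single q 1 = 0,
        shear (Pi.single q 1) (∑ i ∈ s, Pi.single i (f i)) h' ∈ H := by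
    intro s
    induction s using Finset.induction_on with
    | empty =>
      intro _ h'
      rw [shear_eq_one _ (by simp)]
      exact H.one_mem
    | insert k s hk ih =>
      intro hq h'
      rw [Finset.mem_insert, not_or] at hq
      have h1 : (Pi.single k (f k) : Fin n → K) ⬝ᵥ Pi.single q 1 = 0 := by
        simp [hq.1]
      have h2 : (∑ i ∈ s, Pi.single i (f i) : Fin n → K) ⬝ᵥ Pi.single q 1 = 0 := by
        rw [dotProduct_single_one, sum_single_apply_of_notMem f hq.2]
      have h3 := shear_mul_right h1 h2 (by rw [add_dotProduct, h1, h2, add_zero])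
      simp only [Finset.sum_insert hk] at h' ⊢
      rw [← h3]
      refine H.mul_mem (hH k (Ne.symm hq.1) _ ?_) (ih hq.2 h2)
      rw [transvection_eq_vecMulVec]
      simp only [shear]
      congr 1
      ext i j
      simp only [vecMulVec_apply, Pi.single_apply]
      split_ifs <;> simp
  have hf' : (∑ i ∈ Finset.univ.erase q, Pi.single i (f i) : Fin n → K) = f := by
    conv_rhs => rw [← Finset.univ_sum_single f]
    rw [← Finset.add_sum_erase _ _ (Finset.mem_univ q), hf]
    simp
  have := key (Finset.univ.erase q) (by simp) (by rw [hf']; exact h)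
  simpa only [hf'] using this

/-- The entry at `(p, q)` is the only non-zero one in its row and in its column. -/
def Cleared (M : Matrix (Fin n) (Fin n) K) (p q : Fin n) : Prop :=
  M p q ≠ 0 ∧ (∀ j, j ≠ q → M p j = 0) ∧ ∀ i, i ≠ p → M i q = 0

/-- The matrix of `e_i ↦ t_{w(i)} e_{w(i)}`. -/
def monoMat (t : Fin n → Kˣ) (w : Equiv.Perm (Fin n)) : Matrix (Fin n) (Fin n) K :=
  fun k i => if k = w i then (t k : K) else 0

/-- Invertibility puts a non-zero entry into every column. Clearedness makes it the only one in its
row and column, so its row number is a permutation of the column number. -/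
theorem exists_eq_monoMat {g : GL (Fin n) K} (h : ∀ p q, g.1 p q ≠ 0 → Cleared g.1 p q) :
    ∃ t w, g.1 = monoMat t w := by
  have hne : ∀ q, ∃ p, g.1 p q ≠ 0 := by
    intro q
    by_contra! hc
    have h1 : g.1 *ᵥ Pi.single q 1 = 0 := by
      ext i; simpa using hc i
    have h2 : (Pi.single q 1 : Fin n → K) = 0 := by
      have : (g⁻¹).1 *ᵥ (g.1 *ᵥ Pi.single q 1) = (Pi.single q 1 : Fin n → K) := by
        rw [mulVec_mulVec, ← Units.val_mul, inv_mul_cancel, Units.val_one, one_mulVec]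
      rw [← this, h1, mulVec_zero]
    simpa using congrFun h2 q
  choose f hf using hne
  have hinj : Function.Injective f := by
    intro q q' hqq
    by_contra hne
    exact hf q ((h _ _ (hqq ▸ hf q' : g.1 (f q) q' ≠ 0)).2.1 q hne)
  let w : Equiv.Perm (Fin n) := Equiv.ofBijective f (Finite.injective_iff_bijective.1 hinj)
  have hw : ∀ i, w i = f i := fun i => rfl
  refine ⟨fun k => Units.mk0 (g.1 k (w.symm k)) ?_, w, ?_⟩
  · have := hf (w.symm k)
    rwa [← hw, Equiv.apply_symm_apply] at this
  · ext k i
    unfold monoMat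
    split_ifs with hk
    · subst hk; simp
    · exact (h _ _ (hf i)).2.2 k hk

variable [ValuativeRel K] [TopologicalSpace K] [IsNonarchimedeanLocalField K]

/-- The group generated by the elementary matrices with entry `ω` at the place `(i, j)` such that
`|ω| c_i ≤ c_j`. -/
def Elem (c : Fin n → ℝ≥0) : Subgroup (GL (Fin n) K) :=
  Subgroup.closure {g | ∃ (i j : Fin n) (ω : K), i ≠ j ∧ absK ω * c i ≤ c j ∧
    g.1 = transvection i j ω}

theorem mem_Elem_of_eq {c : Fin n → ℝ≥0} {i j : Fin n} {ω : K} (hij : i ≠ j)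
    (h : absK ω * c i ≤ c j) {g : GL (Fin n) K} (hg : g.1 = transvection i j ω) : g ∈ Elem c :=
  Subgroup.subset_closure ⟨i, j, ω, hij, h, hg⟩

/-- One pivot step. The multipliers `g_iq / g_pq` and `g_pj / g_pq` satisfy the bounds defining
`Elem d` and `Elem c` exactly by `hrow` and `hcol`. A position cleared earlier lies in another row
and another column than the pivot, and the zeros around it keep it cleared. -/
theorem exists_clear {c d : Fin n → ℝ≥0} {g : GL (Fin n) K} {p q : Fin n} (h0 : g.1 p q ≠ 0)
    (hpq : ¬ Cleared g.1 p q)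
    (hrow : ∀ i, absK (g.1 i q) * d i ≤ absK (g.1 p q) * d p)
    (hcol : ∀ j, absK (g.1 p j) * c q ≤ absK (g.1 p q) * c j) :
    ∃ u ∈ Elem d, ∃ h ∈ Elem c, Cleared (u * g * h).1 p q ∧
      ∀ p' q', Cleared g.1 p' q' → Cleared (u * g * h).1 p' q' := by
  have hA0 : 0 < absK (g.1 p q) := pos_iff_ne_zero.2 (absK_ne_zero.2 h0)
  let a : Fin n → K := fun i => if i = p then 0 else -(g.1 i q / g.1 p q)
  let f : Fin n → K := fun j => if j = q then 0 else -(g.1 p j / g.1 p q)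
  have ha : Pi.single p 1 ⬝ᵥ a = 0 := by simp [a]
  have hf : f ⬝ᵥ Pi.single q 1 = 0 := by simp [f]
  have hu : shear a (Pi.single p 1) ha ∈ Elem d := by
    refine shear_col_mem _ (by simp [a]) (fun i hi g' hg' => mem_Elem_of_eq hi ?_ hg') _
    simp only [a, if_neg hi, absK_neg, map_div₀]
    rw [div_mul_eq_mul_div, div_le_iff₀ hA0, mul_comm (d p)]
    exact hrow i
  have hh : shear (Pi.single q 1) f hf ∈ Elem c := by
    refine shear_row_mem _ (by simp [f]) (fun j hj g' hg' => mem_Elem_of_eq hj.symm ?_ hg') _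
    simp only [f, if_neg hj, absK_neg, map_div₀]
    rw [div_mul_eq_mul_div, div_le_iff₀ hA0, mul_comm (c j)]
    exact hcol j
  refine ⟨_, hu, _, hh, ?_⟩
  -- For `i ≠ p` this is the Schur complement, which already vanishes for `j = q`.
  have hN : ∀ i j, (shear a (Pi.single p 1) ha * g * shear (Pi.single q 1) f hf).1 i j =
      if i = p then (if j = q then g.1 p q else 0) else g.1 i j - g.1 i q / g.1 p q * g.1 p j := by
    intro i j
    have h1 : ∀ l, ((1 + vecMulVec a (Pi.single p 1)) * g.1) i l = g.1 i l + a i * g.1 p l := by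
      intro l
      rw [add_mul, one_mul, vecMulVec_mul, Matrix.add_apply, vecMulVec_apply, single_one_vecMul]
      rfl
    have h2 : (shear a (Pi.single p 1) ha * g * shear (Pi.single q 1) f hf).1 i j =
        (g.1 i j + a i * g.1 p j) + (g.1 i q + a i * g.1 p q) * f j := by
      simp only [Units.val_mul, shear]
      rw [mul_add, mul_one, mul_vecMulVec, Matrix.add_apply, h1, vecMulVec_apply, mulVec_single_one]
      congr 2
      exact h1 q
    rw [h2]
    simp only [a, f]
    by_cases hi : i = p
    · subst hi
      by_cases hj : j = q
      · subst hj; simp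
      · simp only [if_true, hj, if_false]; field_simp; ring
    · simp only [hi, if_false]; split_ifs <;> field_simp <;> ring
  refine ⟨⟨?_, ?_, ?_⟩, ?_⟩
  · simpa [hN] using h0
  · intro j hj; simp [hN, hj]
  · intro i hi; simp [hN, hi, h0]
  · intro p' q' hc
    have hp : p' ≠ p := by
      rintro rfl
      by_cases hq : q = q'
      · subst hq; exact hpq hc
      · exact h0 (hc.2.1 _ hq)
    have hq : q' ≠ q := by
      rintro rfl
      exact h0 (hc.2.2 _ hp.symm)
    refine ⟨?_, ?_, ?_⟩
    · simpa [hN, hp, hc.2.1 q hq.symm] using hc.1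
    · intro j hj
      simp [hN, hp, hc.2.1 q hq.symm, hc.2.1 j hj]
    · intro i hi
      rw [hN]
      split_ifs with h1
      · rfl
      · simp [hc.2.2 i hi, hc.2.2 p hp.symm]

/-- For positive weights, a position maximizing `A i j * d i / c j` has both properties. Since
weights may vanish, they are first shifted by `ε > 0`. As `S` is finite, one position serves for
arbitrarily small `ε`, and the weak inequalities pass to the limit. -/
theorem exists_pivot (A : Fin n → Fin n → ℝ≥0) (c d : Fin n → ℝ≥0)
    {S : Finset (Fin n × Fin n)} (hS : S.Nonempty) :
    ∃ x ∈ S, (∀ i, (i, x.2) ∈ S → A i x.2 * d i ≤ A x.1 x.2 * d x.1) ∧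
      ∀ j, (x.1, j) ∈ S → A x.1 j * c x.2 ≤ A x.1 x.2 * c j := by
  have key : ∀ᶠ ε : ℝ≥0 in 𝓝[>] 0, ∃ x ∈ S,
      (∀ i, (i, x.2) ∈ S → A i x.2 * (d i + ε) ≤ A x.1 x.2 * (d x.1 + ε)) ∧
      ∀ j, (x.1, j) ∈ S → A x.1 j * (c x.2 + ε) ≤ A x.1 x.2 * (c j + ε) := by
    filter_upwards [self_mem_nhdsWithin] with ε hε
    have hε' : 0 < ε := hε
    obtain ⟨x, hx, hmax⟩ := S.exists_max_image
      (fun x => A x.1 x.2 * (d x.1 + ε) / (c x.2 + ε)) hS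
    have hpos : ∀ r : ℝ≥0, 0 < r + ε := fun r => add_pos_of_nonneg_of_pos zero_le hε'
    refine ⟨x, hx, fun i hi => ?_, fun j hj => ?_⟩
    · have := hmax _ hi
      rwa [div_le_div_iff_of_pos_right (hpos _)] at this
    · have := hmax _ hj
      simp only at this
      rw [div_le_div_iff₀ (hpos _) (hpos _)] at this
      refine le_of_mul_le_mul_right ?_ (hpos (d x.1))
      calc _ = A x.1 j * (d x.1 + ε) * (c x.2 + ε) := by ring
        _ ≤ _ := this
        _ = _ := by ring
  by_contra! hcon
  have hne : ∀ x ∈ S, ∀ᶠ ε : ℝ≥0 in 𝓝[>] 0,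
      ¬ ((∀ i, (i, x.2) ∈ S → A i x.2 * (d i + ε) ≤ A x.1 x.2 * (d x.1 + ε)) ∧
      ∀ j, (x.1, j) ∈ S → A x.1 j * (c x.2 + ε) ≤ A x.1 x.2 * (c j + ε)) := by
    intro x hx
    by_contra hfr
    rw [← Filter.Frequently] at hfr
    have lim : ∀ r s : ℝ≥0, Tendsto (fun ε : ℝ≥0 => r * (s + ε)) (𝓝[>] 0) (𝓝 (r * s)) := by
      intro r s
      have : Continuous fun ε : ℝ≥0 => r * (s + ε) := by fun_prop
      simpa using (this.tendsto 0).mono_left nhdsWithin_le_nhds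
    obtain ⟨j, hj, hlt⟩ := hcon x hx fun i hi =>
      le_of_tendsto_of_tendsto_of_frequently (lim _ _) (lim _ _) (hfr.mono fun ε h => h.1 i hi)
    exact hlt.not_ge
      (le_of_tendsto_of_tendsto_of_frequently (lim _ _) (lim _ _) (hfr.mono fun ε h => h.2 j hj))
  obtain ⟨ε, ⟨x, hx, h1⟩, h2⟩ := (key.and ((Filter.eventually_all_finset S).2 hne)).exists
  exact h2 x hx h1

/-- Every invertible matrix becomes monomial after multiplication by suitable elementary matrices
from both sides. -/
theorem exists_elem_mul_mul_eq_monoMat (c d : Fin n → ℝ≥0) (g : GL (Fin n) K) :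
    ∃ u ∈ Elem d, ∃ h ∈ Elem c, ∃ t w, (u * g * h).1 = monoMat t w := by
  classical
  -- Each pivot step strictly increases the number of cleared positions, which is at most `n²`.
  induction hk : n * n - (Finset.univ.filter fun x : Fin n × Fin n => Cleared g.1 x.1 x.2).card
    using Nat.strong_induction_on generalizing g with
  | _ k ih =>
  by_cases hall : ∀ p q, g.1 p q ≠ 0 → Cleared g.1 p q
  · obtain ⟨t, w, h⟩ := exists_eq_monoMat hall
    exact ⟨1, one_mem _, 1, one_mem _, t, w, by simpa using h⟩
  push Not at hall
  obtain ⟨p₀, q₀, h0, hc0⟩ := hall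
  let S : Finset (Fin n × Fin n) :=
    Finset.univ.filter fun x => g.1 x.1 x.2 ≠ 0 ∧ ¬ Cleared g.1 x.1 x.2
  have hS : ∀ x, x ∈ S ↔ g.1 x.1 x.2 ≠ 0 ∧ ¬ Cleared g.1 x.1 x.2 := by simp [S]
  obtain ⟨⟨p, q⟩, hx, h1, h2⟩ := exists_pivot (fun i j => absK (g.1 i j)) c d
    ⟨(p₀, q₀), (hS _).2 ⟨h0, hc0⟩⟩
  rw [hS] at hx
  obtain ⟨hx0, hxc⟩ := hx
  -- The pivot is only compared with entries in `S`, but every other entry of its row or column is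
  -- zero: a cleared one would force the pivot to vanish or to be cleared.
  have hrow : ∀ i, absK (g.1 i q) * d i ≤ absK (g.1 p q) * d p := by
    intro i
    by_cases hi : g.1 i q = 0
    · simp [hi]
    refine h1 i ((hS _).2 ⟨hi, fun hcl => ?_⟩)
    by_cases hip : p = i
    · subst hip; exact hxc hcl
    · exact hx0 (hcl.2.2 p hip)
  have hcol : ∀ j, absK (g.1 p j) * c q ≤ absK (g.1 p q) * c j := by
    intro j
    by_cases hj : g.1 p j = 0
    · simp [hj]
    refine h2 j ((hS _).2 ⟨hj, fun hcl => ?_⟩)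
    by_cases hjq : q = j
    · subst hjq; exact hxc hcl
    · exact hx0 (hcl.2.1 q hjq)
  obtain ⟨u, hu, h, hh, hnew, hold⟩ := exists_clear hx0 hxc hrow hcol
  have hlt : (Finset.univ.filter fun x : Fin n × Fin n => Cleared g.1 x.1 x.2).card <
      (Finset.univ.filter fun x : Fin n × Fin n => Cleared (u * g * h).1 x.1 x.2).card := by
    apply Finset.card_lt_card
    rw [Finset.ssubset_iff_of_subset]
    · exact ⟨(p, q), by simpa using hnew, by simpa using hxc⟩
    · intro x hx
      simp only [Finset.mem_filter, Finset.mem_univ, true_and] at hx ⊢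
      exact hold _ _ hx
  have hle : (Finset.univ.filter fun x : Fin n × Fin n => Cleared (u * g * h).1 x.1 x.2).card ≤
      n * n := by
    refine (Finset.card_le_univ _).trans ?_
    simp
  obtain ⟨u', hu', h', hh', t, w, hm⟩ := ih _ (by omega) (u * g * h) rfl
  exact ⟨u' * u, mul_mem hu' hu, h * h', mul_mem hh hh', t, w, by simpa only [mul_assoc] using hm⟩

theorem transvection_mulVec_apply (i j k : Fin n) (ω : K) (x : Fin n → K) :
    (transvection i j ω *ᵥ x) k = x k + if k = i then ω * x j else 0 := by
  rw [transvection_eq_vecMulVec, add_mulVec, one_mulVec, vecMulVec_mulVec, Pi.add_apply]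
  by_cases hk : k = i
  · subst hk; simp
  · simp [hk]

theorem monoMat_mulVec_apply (t : Fin n → Kˣ) (w : Equiv.Perm (Fin n)) (x : Fin n → K)
    (i : Fin n) : (monoMat t w *ᵥ x) (w i) = t (w i) * x i := by
  simp only [mulVec, dotProduct, monoMat]
  rw [Finset.sum_eq_single i]
  · simp
  · intro j _ hj; simp [hj.symm]
  · simp

/-- Only coordinate `i` changes, by `ω x_j`, and `|ω x_j| c_i ≤ |x_j| c_j`; the ultrametric
inequality does the rest. -/
theorem sn_transvection_le {c : Fin n → ℝ≥0} {i j : Fin n} {ω : K} (h : absK ω * c i ≤ c j)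
    (x : Fin n → K) : sn c (transvection i j ω *ᵥ x) ≤ sn c x := by
  refine sn_le_iff.2 fun k => ?_
  rw [transvection_mulVec_apply]
  split_ifs with hk
  · subst hk
    have h1 : absK (ω * x j) * c k ≤ sn c x := by
      calc absK (ω * x j) * c k = absK (x j) * (absK ω * c k) := by rw [map_mul]; ring
        _ ≤ absK (x j) * c j := by gcongr
        _ ≤ _ := le_sn _ _ _
    calc _ ≤ max (absK (x k)) (absK (ω * x j)) * c k := by gcongr; exact absK_add_le _ _
      _ = max (absK (x k) * c k) (absK (ω * x j) * c k) := max_mul_of_nonneg _ _ zero_le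
      _ ≤ _ := max_le (le_sn _ _ _) h1
  · rw [add_zero]; exact le_sn _ _ _

theorem sn_of_mem_Elem {c : Fin n → ℝ≥0} {g : GL (Fin n) K} (hg : g ∈ Elem c) (x : Fin n → K) :
    sn c (g.1 *ᵥ x) = sn c x := by
  unfold Elem at hg
  induction hg using Subgroup.closure_induction generalizing x with
  | mem g hg =>
    obtain ⟨i, j, ω, hij, h, hg⟩ := hg
    rw [hg]
    refine le_antisymm (sn_transvection_le h x) ?_
    calc sn c x = sn c (transvection i j (-ω) *ᵥ (transvection i j ω *ᵥ x)) := by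
            rw [mulVec_mulVec, transvection_mul_transvection_same _ _ hij]; simp
      _ ≤ _ := sn_transvection_le (by rwa [absK_neg]) _
  | one => simp
  | mul g h _ _ ihg ihh => rw [Units.val_mul, ← mulVec_mulVec, ihg, ihh]
  | inv g _ ih =>
    rw [← ih, mulVec_mulVec, ← Units.val_mul]
    simp

theorem sn_monoMat (c : Fin n → ℝ≥0) (t : Fin n → Kˣ) (w : Equiv.Perm (Fin n)) (x : Fin n → K) :
    sn c (monoMat t w *ᵥ x) = sn (fun i => absK (t (w i) : K) * c (w i)) x := by
  refine le_antisymm (sn_le_iff.2 fun k => ?_) (sn_le_iff.2 fun i => ?_)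
  · obtain ⟨i, rfl⟩ := w.surjective k
    rw [monoMat_mulVec_apply]
    refine le_trans (le_of_eq ?_) (le_sn _ _ i)
    rw [map_mul]; ring
  · refine le_trans (le_of_eq ?_) (le_sn _ _ (w i))
    rw [monoMat_mulVec_apply, map_mul]; ring

end Elimination

/-! ### The compactified apartment as a space of weights up to homothety -/

section Apartment

variable {n : ℕ}

/-- The map `r ↦ e^{-r}` with values in the non-negative reals. -/
def expNeg (r : ℝ) : ℝ≥0 := Real.toNNReal (Real.exp (-r))

theorem coe_expNeg (r : ℝ) : (expNeg r : ℝ) = Real.exp (-r) :=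
  Real.coe_toNNReal _ (Real.exp_pos _).le

theorem expNeg_pos (r : ℝ) : 0 < expNeg r := by
  rw [← NNReal.coe_pos, coe_expNeg]; exact Real.exp_pos _

theorem expNeg_ne_zero (r : ℝ) : expNeg r ≠ 0 := (expNeg_pos r).ne'

theorem expNeg_neg_log {c : ℝ≥0} (hc : c ≠ 0) : expNeg (-Real.log c) = c := by
  apply NNReal.coe_injective
  rw [coe_expNeg, neg_neg, Real.exp_log (NNReal.coe_pos.2 (pos_iff_ne_zero.2 hc))]

theorem neg_log_expNeg (r : ℝ) : -Real.log (expNeg r) = r := by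
  rw [coe_expNeg, Real.log_exp, neg_neg]

theorem expNeg_add (r s : ℝ) : expNeg (r + s) = expNeg r * expNeg s := by
  apply NNReal.coe_injective
  rw [NNReal.coe_mul, coe_expNeg, coe_expNeg, coe_expNeg, ← Real.exp_add]
  ring_nf

theorem expNeg_le_iff {r s : ℝ} : expNeg r ≤ expNeg s ↔ s ≤ r := by
  rw [← NNReal.coe_le_coe, coe_expNeg, coe_expNeg, Real.exp_le_exp, neg_le_neg_iff]

theorem continuous_expNeg : Continuous expNeg :=
  continuous_real_toNNReal.comp (by fun_prop)

theorem le_expNeg_iff {c : ℝ≥0} (hc : c ≠ 0) {r : ℝ} : c ≤ expNeg r ↔ r ≤ -Real.log c := by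
  rw [← expNeg_le_iff, expNeg_neg_log hc]

theorem abar_mk_eq_iff {I J : Finset (Fin n)} (hI : I.Nonempty) (hJ : J.Nonempty) (f : I → ℝ)
    (g : J → ℝ) :
    (⟨I, hI, Submodule.Quotient.mk f⟩ : Abar n) = ⟨J, hJ, Submodule.Quotient.mk g⟩ ↔
      I = J ∧ ∃ k : ℝ, ∀ i (hi : i ∈ I) (hj : i ∈ J), f ⟨i, hi⟩ = g ⟨i, hj⟩ + k := by
  constructor
  · intro h
    obtain ⟨h1, h2⟩ := Abar.mk.inj h
    subst h1
    refine ⟨rfl, ?_⟩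
    obtain ⟨k, hk⟩ := Submodule.mem_span_singleton.1 ((Submodule.Quotient.eq _).1 (eq_of_heq h2))
    refine ⟨k, fun i hi _ => ?_⟩
    have := congrFun hk ⟨i, hi⟩
    simp at this
    linarith
  · rintro ⟨h1, k, hk⟩
    subst h1
    congr 1
    refine (Submodule.Quotient.eq _).2 (Submodule.mem_span_singleton.2 ⟨k, ?_⟩)
    ext i
    have := hk i.1 i.2 i.2
    simp [this]

/-- The weights `e^{-f_i}` for `i ∈ I` and `0` for `i ∉ I`. -/
def wt (I : Finset (Fin n)) (f : I → ℝ) (i : Fin n) : ℝ≥0 :=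
  if h : i ∈ I then expNeg (f ⟨i, h⟩) else 0

theorem wt_ne_zero_iff {I : Finset (Fin n)} {f : I → ℝ} {i : Fin n} : wt I f i ≠ 0 ↔ i ∈ I := by
  unfold wt
  split_ifs with h
  · simp [h, expNeg_ne_zero]
  · simp [h]

/-- The set of indices with non-zero weight. -/
def supp (c : Fin n → ℝ≥0) : Finset (Fin n) := Finset.univ.filter fun i => c i ≠ 0

theorem mem_supp {c : Fin n → ℝ≥0} {i : Fin n} : i ∈ supp c ↔ c i ≠ 0 := by simp [supp]

theorem supp_nonempty {c : Fin n → ℝ≥0} : (supp c).Nonempty ↔ c ≠ 0 := by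
  rw [Function.ne_iff]
  exact exists_congr fun i => mem_supp

/-- Division by the maximal weight. -/
def nrm {ι : Type*} [Fintype ι] (c : ι → ℝ≥0) (i : ι) : ℝ≥0 := c i / Finset.univ.sup c

theorem sup_ne_zero {c : Fin n → ℝ≥0} (hc : c ≠ 0) : Finset.univ.sup c ≠ 0 := by
  obtain ⟨i, hi⟩ := Function.ne_iff.1 hc
  exact ((pos_iff_ne_zero.2 hi).trans_le (Finset.le_sup (Finset.mem_univ i))).ne'

theorem nrm_eq_smul (c : Fin n → ℝ≥0) : nrm c = (Finset.univ.sup c)⁻¹ • c := by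
  ext i
  simp [nrm, div_eq_inv_mul]

theorem sup_smul (r : ℝ≥0) (c : Fin n → ℝ≥0) :
    Finset.univ.sup (r • c) = r * Finset.univ.sup c := by
  rw [NNReal.mul_finset_sup]; rfl

theorem nrm_smul {r : ℝ≥0} (hr : r ≠ 0) (c : Fin n → ℝ≥0) : nrm (r • c) = nrm c := by
  ext i
  simp only [nrm, sup_smul, Pi.smul_apply, smul_eq_mul]
  rw [mul_div_mul_left _ _ hr]

theorem sup_nrm {c : Fin n → ℝ≥0} (hc : c ≠ 0) : Finset.univ.sup (nrm c) = 1 := by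
  rw [nrm_eq_smul, sup_smul, inv_mul_cancel₀ (sup_ne_zero hc)]

theorem continuous_sup : Continuous fun c : Fin n → ℝ≥0 => Finset.univ.sup c := by
  have h : (fun c : Fin n → ℝ≥0 => Finset.univ.sup c) =
      Finset.univ.sup fun (i : Fin n) (c : Fin n → ℝ≥0) => c i := by
    ext c
    simp only [Finset.sup_apply]
  rw [h]
  exact Continuous.finset_sup fun i _ => continuous_apply i

theorem continuousAt_nrm {c : Fin n → ℝ≥0} (hc : c ≠ 0) : ContinuousAt nrm c :=
  continuousAt_pi.2 fun i => ContinuousAt.div₀ (continuous_apply i).continuousAt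
    continuous_sup.continuousAt (sup_ne_zero hc)

/-- A representative of the homothety class of weights given by a point of the compactified
apartment. -/
def coord (p : Abar n) : Fin n → ℝ≥0 := wt p.I (Quotient.out p.pt)

/-- The weights given by a point of the compactified apartment, normalized to have maximum `1`. -/
def nc (p : Abar n) : Fin n → ℝ≥0 := nrm (coord p)

theorem coord_ne_zero (p : Abar n) : coord p ≠ 0 := by
  obtain ⟨i, hi⟩ := p.nonempty
  exact fun h => wt_ne_zero_iff.2 hi (congrFun h i)

theorem exists_nc_eq (p : Abar n) : ∃ r : ℝ≥0, r ≠ 0 ∧ nc p = r • coord p :=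
  ⟨_, inv_ne_zero (sup_ne_zero (coord_ne_zero p)), nrm_eq_smul _⟩

theorem nc_ne_zero (p : Abar n) : nc p ≠ 0 := by
  obtain ⟨r, hr, h⟩ := exists_nc_eq p
  rw [h]
  exact smul_ne_zero hr (coord_ne_zero p)

theorem sum_smul_eta (I : Finset (Fin n)) (c : Fin n → ℝ) : ∑ i ∈ Iᶜ, c i • (eta i : Apt n) =
    Submodule.Quotient.mk fun i => if i ∈ I then 0 else c i := by
  have h1 : ∀ i, c i • (eta i : Apt n) =
      Submodule.mkQ (Submodule.span ℝ {(1 : Fin n → ℝ)}) (Pi.single i (c i)) := by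
    intro i
    rw [eta, ← Submodule.mkQ_apply, ← map_smul, ← Pi.single_smul]
    simp
  simp only [h1, ← map_sum, ← Submodule.mkQ_apply]
  congr 1
  ext i
  rw [Finset.sum_apply]
  split_ifs with hi
  · refine Finset.sum_eq_zero fun j hj => Pi.single_eq_of_ne ?_ _
    rintro rfl
    exact Finset.mem_compl.1 hj hi
  · rw [Finset.sum_eq_single i (fun j _ hj => Pi.single_eq_of_ne hj.symm _)
      (fun h => absurd (Finset.mem_compl.2 hi) h)]
    simp

theorem isBounded_mk_image {s : Set (Fin n → ℝ)} (hs : Bornology.IsBounded s) :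
    Bornology.IsBounded ((Submodule.Quotient.mk : (Fin n → ℝ) → Apt n) '' s) := by
  obtain ⟨r, hr⟩ := hs.exists_norm_le
  refine isBounded_iff_forall_norm_le.2 ⟨r, ?_⟩
  rintro _ ⟨x, hx, rfl⟩
  exact (Submodule.Quotient.norm_mk_le _ x).trans (hr x hx)

variable [NeZero n]

/-- The point of the compactified apartment given by a non-zero system of weights. -/
def ofWt (c : Fin n → ℝ≥0) : Abar n :=
  if h : (supp c).Nonempty then
    ⟨supp c, h, Submodule.Quotient.mk fun i => -Real.log (c i)⟩ else incl 0

theorem ofWt_of_ne_zero {c : Fin n → ℝ≥0} (hc : c ≠ 0) : ofWt c =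
    ⟨supp c, supp_nonempty.2 hc, Submodule.Quotient.mk fun i => -Real.log (c i)⟩ :=
  dif_pos (supp_nonempty.2 hc)

theorem ofWt_wt {I : Finset (Fin n)} (hI : I.Nonempty) (f : I → ℝ) :
    ofWt (wt I f) = ⟨I, hI, Submodule.Quotient.mk f⟩ := by
  have h0 : wt I f ≠ 0 := fun h => wt_ne_zero_iff.2 hI.choose_spec (congrFun h hI.choose)
  rw [ofWt_of_ne_zero h0, abar_mk_eq_iff]
  refine ⟨by ext i; rw [mem_supp, wt_ne_zero_iff], 0, fun i hi hj => ?_⟩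
  simp only [wt, hj, dif_pos, neg_log_expNeg, add_zero]

theorem ofWt_coord (p : Abar n) : ofWt (coord p) = p := by
  obtain ⟨I, hI, f⟩ := p
  rw [coord, ofWt_wt hI]
  congr 1
  exact Quotient.out_eq f

theorem ofWt_smul {r : ℝ≥0} (hr : r ≠ 0) {c : Fin n → ℝ≥0} (hc : c ≠ 0) :
    ofWt (r • c) = ofWt c := by
  rw [ofWt_of_ne_zero hc, ofWt_of_ne_zero (smul_ne_zero hr hc), abar_mk_eq_iff]
  refine ⟨by ext i; simp [mem_supp, hr], -Real.log r, fun i hi hj => ?_⟩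
  rw [mem_supp] at hj
  simp only [Pi.smul_apply, smul_eq_mul, NNReal.coe_mul]
  rw [Real.log_mul (NNReal.coe_ne_zero.2 hr) (NNReal.coe_ne_zero.2 hj)]
  ring

theorem exists_smul_of_ofWt_eq {c d : Fin n → ℝ≥0} (hc : c ≠ 0) (hd : d ≠ 0)
    (h : ofWt c = ofWt d) : ∃ r : ℝ≥0, r ≠ 0 ∧ c = r • d := by
  rw [ofWt_of_ne_zero hc, ofWt_of_ne_zero hd, abar_mk_eq_iff] at h
  obtain ⟨h1, k, hk⟩ := h
  refine ⟨expNeg k, expNeg_ne_zero k, ?_⟩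
  ext1 i
  by_cases hi : c i = 0
  · have : d i = 0 := by
      by_contra hdi
      rw [← ne_eq, ← mem_supp, ← h1, mem_supp] at hdi
      exact hdi hi
    simp [hi, this]
  · have hi1 : i ∈ supp c := mem_supp.2 hi
    have hi2 : i ∈ supp d := h1 ▸ hi1
    have := hk i hi1 hi2
    simp only at this
    rw [← expNeg_neg_log hi, this, expNeg_add, expNeg_neg_log (mem_supp.1 hi2), mul_comm]
    rfl

theorem ofWt_nc (p : Abar n) : ofWt (nc p) = p := by
  obtain ⟨r, hr, h⟩ := exists_nc_eq p
  rw [h, ofWt_smul hr (coord_ne_zero p), ofWt_coord]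

theorem nc_ofWt {c : Fin n → ℝ≥0} (hc : c ≠ 0) : nc (ofWt c) = nrm c := by
  obtain ⟨r, hr, h⟩ := exists_smul_of_ofWt_eq (coord_ne_zero (ofWt c)) hc (ofWt_coord _)
  rw [nc, h, nrm_smul hr]

theorem eq_of_coord_eq_smul {p q : Abar n} {r : ℝ≥0} (hr : r ≠ 0) (h : coord p = r • coord q) :
    p = q := by
  rw [← ofWt_coord p, h, ofWt_smul hr (coord_ne_zero q), ofWt_coord]

/-! ### The topology of the compactified apartment -/

/-- Adding the cone `Δ_I` raises coordinates outside `I`, that is, lowers their weights, and `s_J`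
makes the weights outside `J` zero. The additive constant left free by the quotient is absorbed into
the representative `z`. -/
theorem ofWt_mem_Gam {c : Fin n → ℝ≥0} (hc : c ≠ 0) {U : Set (Apt n)} {I : Finset (Fin n)} :
    ofWt c ∈ Gam U I ↔ ∃ z : Fin n → ℝ, Submodule.Quotient.mk z ∈ U ∧
      (∀ i ∈ I, c i = expNeg (z i)) ∧ ∀ i, c i ≤ expNeg (z i) := by
  rw [ofWt_of_ne_zero hc]
  constructor
  · rintro ⟨hI, _, ⟨u, hu, _, ⟨γ, hγ, rfl⟩, rfl⟩, hz⟩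
    obtain ⟨u, rfl⟩ := Submodule.Quotient.mk_surjective _ u
    rw [sum_smul_eta] at hz
    obtain ⟨k, hk⟩ := Submodule.mem_span_singleton.1 ((Submodule.Quotient.eq _).1 hz)
    have hk' : ∀ i, c i ≠ 0 → (u i + if i ∈ I then 0 else γ i) = k - Real.log (c i) := by
      intro i hi
      have := congrFun hk ⟨i, mem_supp.2 hi⟩
      simp [LinearMap.funLeft] at this
      linarith
    refine ⟨fun i => u i - k, ?_, fun i hi => ?_, fun i => ?_⟩
    · convert hu using 1
      refine (Submodule.Quotient.eq _).2 (Submodule.mem_span_singleton.2 ⟨-k, ?_⟩)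
      ext i; simp
    · have hi' := mem_supp.1 (hI hi)
      have := hk' i hi'
      rw [if_pos hi] at this
      beta_reduce
      rw [show u i - k = -Real.log (c i) by linarith, expNeg_neg_log hi']
    · by_cases hi' : c i = 0
      · simp [hi']
      rw [le_expNeg_iff hi']
      have := hk' i hi'
      split_ifs at this with hi
      · linarith
      · linarith [hγ i]
  · rintro ⟨z, hz, h1, h2⟩
    refine ⟨fun i hi => mem_supp.2 (by rw [h1 i hi]; exact expNeg_ne_zero _), _,
      -- Coordinates of weight zero are forgotten by the projection, so any non-negative coefficient
      -- would do there.
      Set.add_mem_add hz ⟨fun i => if c i = 0 then 0 else -Real.log (c i) - z i, fun i => ?_, rfl⟩,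
      ?_⟩
    · beta_reduce
      split_ifs with hi
      · exact le_rfl
      · have := (le_expNeg_iff hi).1 (h2 i)
        linarith
    · rw [sum_smul_eta]
      refine (Submodule.Quotient.eq _).2 (Submodule.mem_span_singleton.2 ⟨0, ?_⟩)
      ext ⟨i, hi⟩
      have hi' := mem_supp.1 hi
      by_cases hiI : i ∈ I
      · have := h1 i hiI
        simp [LinearMap.funLeft, hiI, this, coe_expNeg]
      · simp [LinearMap.funLeft, hiI, hi']

/-- Lets both kinds of generators of the topology be treated as sets `Gam U I`. -/
theorem image_incl_eq_Gam (U : Set (Apt n)) : incl '' U = Gam U Finset.univ := by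
  have hD : (Delta (Finset.univ : Finset (Fin n))) = {0} := by
    ext z
    simp only [Delta, Finset.compl_univ, Finset.sum_empty, Set.mem_ofPred_eq, Set.mem_singleton_iff]
    exact ⟨fun ⟨_, _, h⟩ => h, fun h => ⟨0, fun _ => le_rfl, h⟩⟩
  ext p
  simp only [Gam, hD, Set.add_singleton, add_zero, Set.image_id', Set.mem_ofPred_eq]
  constructor
  · rintro ⟨z, hz, rfl⟩
    exact ⟨subset_rfl, z, hz, rfl⟩
  · obtain ⟨I, hI, x⟩ := p
    rintro ⟨h, z, hz, hx⟩
    obtain rfl : I = Finset.univ := Finset.univ_subset_iff.1 h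
    exact ⟨z, hz, by rw [incl, hx]⟩

theorem preimage_Gam_mem_nhds {c : Fin n → ℝ≥0} (hc : c ≠ 0) {U : Set (Apt n)} (hU : IsOpen U)
    {I : Finset (Fin n)} (h : ofWt c ∈ Gam U I) : ofWt ⁻¹' Gam U I ∈ 𝓝 c := by
  obtain ⟨z, hz, h1, h2⟩ := (ofWt_mem_Gam hc).1 h
  -- On `I` the representative is forced by the weights. Outside `I` it is lowered by a small `ε`,
  -- which turns `c i ≤ e^{-z_i}` into a strict inequality and leaves room for `c` to move, while
  -- openness of `U` absorbs the change.
  let F : ℝ × (Fin n → ℝ≥0) → (Fin n → ℝ) := fun p i =>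
    if i ∈ I then -Real.log (p.2 i) else z i - p.1
  have hF0 : F (0, c) = z := by
    ext i
    simp only [F]
    split_ifs with hi
    · rw [h1 i hi, neg_log_expNeg]
    · simp
  have hF : ContinuousAt F (0, c) := by
    refine continuousAt_pi.2 fun i => ?_
    simp only [F]
    split_ifs with hi
    · have hci : (c i : ℝ) ≠ 0 := by rw [h1 i hi]; exact_mod_cast expNeg_ne_zero _
      have h3 : ContinuousAt (fun p : ℝ × (Fin n → ℝ≥0) => (p.2 i : ℝ)) (0, c) := by fun_prop
      exact (h3.log hci).neg
    · fun_prop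
  have hmk : Continuous (Submodule.Quotient.mk : (Fin n → ℝ) → Apt n) :=
    (Submodule.isOpenQuotientMap_mkQ _).continuous
  have hev : ∀ᶠ p in 𝓝 ((0 : ℝ), c), Submodule.Quotient.mk (F p) ∈ U :=
    (hmk.continuousAt.comp hF).eventually (hU.mem_nhds (by simpa [hF0] using hz))
  obtain ⟨ε, hε, hε0⟩ : ∃ ε : ℝ, (∀ᶠ c' in 𝓝 c, Submodule.Quotient.mk (F (ε, c')) ∈ U) ∧ 0 < ε :=
    ((hev.curry_nhds.filter_mono nhdsWithin_le_nhds).and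
      (self_mem_nhdsWithin : Set.Ioi (0 : ℝ) ∈ 𝓝[>] 0)).exists
  have hne : ∀ᶠ c' : Fin n → ℝ≥0 in 𝓝 c, c' ≠ 0 := isOpen_ne.mem_nhds hc
  have hI : ∀ᶠ c' : Fin n → ℝ≥0 in 𝓝 c, ∀ i, i ∈ I → c' i ≠ 0 := by
    refine eventually_all.2 fun i => ?_
    by_cases hi : i ∈ I
    · have : c i ≠ 0 := by rw [h1 i hi]; exact expNeg_ne_zero _
      filter_upwards [(continuous_apply i).continuousAt.eventually (isOpen_ne.mem_nhds this)]
        with c' hc' _ using hc'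
    · exact Eventually.of_forall fun _ h => absurd h hi
  have hJ : ∀ᶠ c' : Fin n → ℝ≥0 in 𝓝 c, ∀ i, c' i < expNeg (z i - ε) := by
    refine eventually_all.2 fun i => ?_
    have : c i < expNeg (z i - ε) := (h2 i).trans_lt
      (lt_of_not_ge fun h => by have := expNeg_le_iff.1 h; linarith)
    exact (continuous_apply i).continuousAt.eventually_lt_const this
  filter_upwards [hε, hne, hI, hJ] with c' h3 h4 h5 h6
  refine (ofWt_mem_Gam h4).2 ⟨_, h3, fun i hi => ?_, fun i => ?_⟩
  · simp only [F, if_pos hi]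
    rw [expNeg_neg_log (h5 i hi)]
  · simp only [F]
    split_ifs with hi
    · rw [expNeg_neg_log (h5 i hi)]
    · exact (h6 i).le

theorem continuousAt_ofWt {c : Fin n → ℝ≥0} (hc : c ≠ 0) : ContinuousAt ofWt c := by
  rw [ContinuousAt, TopologicalSpace.tendsto_nhds_generateFrom_iff]
  rintro s (⟨U, hU, rfl⟩ | ⟨U, I, hU, -, -, -, rfl⟩) hs
  · rw [image_incl_eq_Gam] at hs ⊢
    exact preimage_Gam_mem_nhds hc hU hs
  · exact preimage_Gam_mem_nhds hc hU hs

theorem isOpen_Gam {U : Set (Apt n)} (hU : IsOpen U) (hb : Bornology.IsBounded U)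
    {I : Finset (Fin n)} (hI : I.Nonempty) : IsOpen (Gam U I) := by
  by_cases h : I = Finset.univ
  · subst h
    rw [← image_incl_eq_Gam]
    exact TopologicalSpace.isOpen_generateFrom_of_mem (Or.inl ⟨U, hU, rfl⟩)
  · exact TopologicalSpace.isOpen_generateFrom_of_mem (Or.inr ⟨U, I, hU, hb, hI, h, rfl⟩)

/-- The neighbourhood used is `Gam U (supp c)`: up to a common factor, its points have weights close
to `c` on `supp c` and small weights elsewhere. Continuity of `nrm` at `c` finishes. -/
theorem continuous_nc : Continuous (nc : Abar n → Fin n → ℝ≥0) := by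
  rw [continuous_iff_continuousAt]
  intro p
  obtain ⟨c, hc, rfl⟩ : ∃ c : Fin n → ℝ≥0, c ≠ 0 ∧ ofWt c = p :=
    ⟨coord p, coord_ne_zero p, ofWt_coord p⟩
  intro V hV
  rw [nc_ofWt hc] at hV
  obtain ⟨ε, hε, hball⟩ := Metric.mem_nhds_iff.1 (continuousAt_nrm hc hV)
  -- Zero weights are raised to `ε / 2` so that logarithms exist; a further error of `ε / 2` keeps
  -- these weights below `ε`.
  let b : Fin n → ℝ≥0 := fun i => if c i = 0 then Real.toNNReal (ε / 2) else c i
  have hb0 : ∀ i, b i ≠ 0 := by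
    intro i
    simp only [b]
    split_ifs with h
    · exact (Real.toNNReal_pos.2 (half_pos hε)).ne'
    · assumption
  let z₀ : Fin n → ℝ := fun i => -Real.log (b i)
  let E : (Fin n → ℝ) → (Fin n → ℝ≥0) := fun z i => expNeg (z i)
  have hE : Continuous E := continuous_pi fun i => continuous_expNeg.comp (continuous_apply i)
  have hE0 : E z₀ = b := by ext1 i; exact expNeg_neg_log (hb0 i)
  obtain ⟨δ, hδ, hδb⟩ := Metric.mem_nhds_iff.1
    (hE.continuousAt (Metric.ball_mem_nhds (E z₀) (half_pos hε)))
  let U : Set (Apt n) := Submodule.Quotient.mk '' Metric.ball z₀ δ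
  have hU : IsOpen U := (Submodule.isOpenQuotientMap_mkQ _).isOpenMap _ Metric.isOpen_ball
  have hmem : ofWt c ∈ Gam U (supp c) := by
    refine (ofWt_mem_Gam hc).2 ⟨z₀, ⟨z₀, Metric.mem_ball_self hδ, rfl⟩, fun i hi => ?_, fun i => ?_⟩
    · rw [expNeg_neg_log (hb0 i)]
      simp [b, mem_supp.1 hi]
    · rw [expNeg_neg_log (hb0 i)]
      simp only [b]
      split_ifs with h
      · rw [h]; exact zero_le
      · exact le_rfl
  rw [mem_map]
  filter_upwards [(isOpen_Gam hU (isBounded_mk_image Metric.isBounded_ball)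
    (supp_nonempty.2 hc)).mem_nhds hmem] with q hq
  rw [← ofWt_coord q, ofWt_mem_Gam (coord_ne_zero q)] at hq
  obtain ⟨z, ⟨z', hz', hzz⟩, h1, h2⟩ := hq
  obtain ⟨k, hk⟩ := Submodule.mem_span_singleton.1 ((Submodule.Quotient.eq _).1 hzz)
  have hk' : ∀ i, z' i = k + z i := by
    intro i
    have := congrFun hk i
    simp at this
    linarith
  -- The factor `e^{-k}` passes from the representative `z` to the one in the ball, and
  -- normalization does not see it.
  have hq : nc q = nrm (expNeg k • coord q) := by rw [nrm_smul (expNeg_ne_zero k), nc]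
  change nc q ∈ V
  rw [hq]
  refine hball ?_
  have hz2 : ∀ i, dist (expNeg (z' i)) (b i) < ε / 2 := by
    intro i
    have := hδb hz'
    rw [Set.mem_preimage, hE0] at this
    exact (dist_le_pi_dist (E z') b i).trans_lt this
  rw [Metric.mem_ball, dist_pi_lt_iff hε]
  intro i
  by_cases hi : c i = 0
  · have hb : b i = Real.toNNReal (ε / 2) := if_pos hi
    have h3 := hz2 i
    rw [hb, NNReal.dist_eq, abs_lt] at h3
    have h4 : expNeg k * coord q i ≤ expNeg (z' i) := by
      rw [hk', expNeg_add]
      exact mul_le_mul_right (h2 i) _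
    have h5 : ((expNeg k * coord q i : ℝ≥0) : ℝ) ≤ expNeg (z' i) := by exact_mod_cast h4
    have h6 := h3.2
    rw [hi, NNReal.dist_eq, NNReal.coe_zero, sub_zero, abs_of_nonneg (NNReal.coe_nonneg _)]
    rw [Real.coe_toNNReal _ (half_pos hε).le] at h6
    change ((expNeg k * coord q i : ℝ≥0) : ℝ) < ε
    linarith
  · have hb : b i = c i := if_neg hi
    have h3 := hz2 i
    rw [hb, hk', expNeg_add, ← h1 i (mem_supp.2 hi)] at h3
    exact h3.trans (half_lt_self hε)

instance compactSpace_Abar : CompactSpace (Abar n) := by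
  have hK : IsCompact {c : Fin n → ℝ≥0 | Finset.univ.sup c = 1} := by
    refine IsCompact.of_isClosed_subset (isCompact_univ_pi fun _ : Fin n => (isCompact_Icc (a := (0 : ℝ≥0)) (b := 1)))
      (isClosed_eq continuous_sup continuous_const) ?_
    intro c hc i _
    exact ⟨zero_le, (Finset.le_sup (f := c) (Finset.mem_univ i)).trans (le_of_eq hc)⟩
  have himg : ofWt '' {c : Fin n → ℝ≥0 | Finset.univ.sup c = 1} = Set.univ :=
    Set.eq_univ_of_forall fun p => ⟨nc p, sup_nrm (coord_ne_zero p), ofWt_nc p⟩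
  refine ⟨?_⟩
  rw [← himg]
  refine hK.image_of_continuousOn fun c hc => (continuousAt_ofWt ?_).continuousWithinAt
  rintro rfl
  have h0 : Finset.univ.sup (0 : Fin n → ℝ≥0) = 0 := by rw [← bot_eq_zero]; exact Finset.sup_bot _
  exact zero_ne_one (h0.symm.trans hc)

end Apartment

/-! ### Closures of half-apartments -/

section ConcaveFunction

variable {n : ℕ} [NeZero n]

theorem incl_mk (z : Fin n → ℝ) :
    incl (Submodule.Quotient.mk z) = ofWt fun i => expNeg (z i) := by
  have h : (fun i => expNeg (z i)) = wt Finset.univ fun i : (Finset.univ : Finset (Fin n)) => z i := by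
    ext i; simp [wt]
  rw [h, ofWt_wt Finset.univ_nonempty]
  rfl

theorem root_mk (i j : Fin n) (z : Fin n → ℝ) :
    root i j (Submodule.Quotient.mk z : Apt n) = z i - z j := rfl

theorem expNeg_mul_le_iff {a b : ℝ≥0} {t : ℝ} : a ≤ expNeg (-t) * b ↔ expNeg t * a ≤ b := by
  have h : expNeg t * expNeg (-t) = 1 := by
    rw [← expNeg_add, add_neg_cancel]
    apply NNReal.coe_injective
    simp [coe_expNeg]
  rw [← mul_le_mul_iff_right₀ (expNeg_pos t), ← mul_assoc, h, one_mul]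

/-- The inequality is homogeneous, hence a closed condition on the normalized weights. Conversely, a
small positive perturbation that respects it moves the point into `A`. -/
theorem ofWt_mem_closure_iff {c : Fin n → ℝ≥0} (hc : c ≠ 0) {i j : Fin n} (hij : i ≠ j) (t : ℝ) :
    ofWt c ∈ closure (incl '' {z : Apt n | -t ≤ root i j z}) ↔ expNeg t * c i ≤ c j := by
  constructor
  · intro h
    have hcl : IsClosed {p : Abar n | nc p i ≤ expNeg (-t) * nc p j} :=
      isClosed_le ((continuous_apply i).comp continuous_nc)
        (continuous_const.mul ((continuous_apply j).comp continuous_nc))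
    have hsub : incl '' {z : Apt n | -t ≤ root i j z} ⊆
        {p : Abar n | nc p i ≤ expNeg (-t) * nc p j} := by
      rintro _ ⟨z, hz, rfl⟩
      obtain ⟨z, rfl⟩ := Submodule.Quotient.mk_surjective _ z
      rw [Set.mem_ofPred_eq, root_mk] at hz
      have hne : (fun i => expNeg (z i)) ≠ 0 := fun h => expNeg_ne_zero _ (congrFun h i)
      rw [Set.mem_ofPred_eq, incl_mk, nc_ofWt hne]
      simp only [nrm]
      rw [← mul_div_assoc]
      gcongr
      rw [← expNeg_add, expNeg_le_iff]
      linarith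
    have := closure_minimal hsub hcl h
    rw [Set.mem_ofPred_eq, nc_ofWt hc, expNeg_mul_le_iff] at this
    simp only [nrm] at this
    rwa [← mul_div_assoc, div_le_div_iff_of_pos_right (pos_iff_ne_zero.2 (sup_ne_zero hc))] at this
  · intro h
    -- Chosen so that `e^{-t} w_i = w_j`: adding a multiple of `w` preserves the inequality.
    let w : Fin n → ℝ≥0 := fun k => if k = i then expNeg (-t) else 1
    let γ : ℝ≥0 → Fin n → ℝ≥0 := fun δ k => c k + δ * w k
    have hw : ∀ k, 0 < w k := by
      intro k
      simp only [w]
      split_ifs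
      · exact expNeg_pos _
      · exact one_pos
    have hγ : Continuous γ := by fun_prop
    have hγ0 : γ 0 = c := by ext k; simp [γ]
    have hlim : Tendsto (fun δ => ofWt (γ δ)) (𝓝[>] 0) (𝓝 (ofWt c)) := by
      have h1 : Tendsto γ (𝓝[>] 0) (𝓝 c) := by
        rw [← hγ0]
        exact (hγ.tendsto 0).mono_left nhdsWithin_le_nhds
      exact (continuousAt_ofWt hc).tendsto.comp h1
    refine mem_closure_of_tendsto hlim ?_
    filter_upwards [self_mem_nhdsWithin] with δ hδ
    have hδ' : 0 < δ := hδ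
    have hpos : ∀ k, γ δ k ≠ 0 := fun k =>
      (add_pos_of_nonneg_of_pos zero_le (mul_pos hδ' (hw k))).ne'
    refine ⟨Submodule.Quotient.mk fun k => -Real.log (γ δ k), ?_, ?_⟩
    · rw [Set.mem_ofPred_eq, root_mk]
      have h1 : γ δ i ≤ expNeg (-t) * γ δ j := by
        simp only [γ, w, if_true, if_neg hij.symm, mul_add]
        refine add_le_add (expNeg_mul_le_iff.2 h) (le_of_eq (by ring))
      rw [← expNeg_neg_log (hpos j), ← expNeg_add, le_expNeg_iff (hpos i)] at h1
      linarith
    · rw [incl_mk]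
      congr 1
      ext1 k
      exact expNeg_neg_log (hpos k)

end ConcaveFunction

/-! ### The groups `U_x` and `P_x` in terms of seminorms -/

section Dictionary

open Matrix

variable {K : Type*} [Field K] [ValuativeRel K] [TopologicalSpace K] [IsNonarchimedeanLocalField K]
variable {V : Type*} [AddCommGroup V] [Module K V] {n : ℕ}

theorem absK_eq_expNeg {ω : K} (h : ω ≠ 0) : absK ω = expNeg (val ω) := by
  apply NNReal.coe_injective
  rw [absK_eq_exp h, coe_expNeg]

/-- The infimum is over all `t` with `e^{-t} c_i ≤ c_j`. This set is closed and closed upwards, so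
the infimum is at most `v(ω)` exactly when `v(ω)` is in it; the infinite values need no separate
treatment. -/
theorem fval_le_valE_iff [NeZero n] (x : Abar n) {i j : Fin n} (hij : i ≠ j) (ω : K) :
    fval x i j ≤ valE ω ↔ absK ω * coord x i ≤ coord x j := by
  by_cases hω : ω = 0
  · simp [hω, valE]
  have hset : {t : ℝ | x ∈ closure (incl '' {z : Apt n | -t ≤ root i j z})} =
      {t | expNeg t * coord x i ≤ coord x j} := by
    ext t
    rw [Set.mem_ofPred_eq, Set.mem_ofPred_eq, ← ofWt_mem_closure_iff (coord_ne_zero x) hij,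
      ofWt_coord]
  rw [fval, valE, if_neg hω, hset, absK_eq_expNeg hω]
  constructor
  · intro h
    have hlim : Tendsto (fun s => expNeg s * coord x i) (𝓝[>] (val ω : ℝ))
        (𝓝 (expNeg (val ω) * coord x i)) :=
      ((continuous_expNeg.mul continuous_const).tendsto _).mono_left nhdsWithin_le_nhds
    refine le_of_tendsto hlim ?_
    filter_upwards [self_mem_nhdsWithin] with s hs
    have hlt := h.trans_lt (EReal.coe_lt_coe_iff.2 hs)
    obtain ⟨_, ⟨t, ht, rfl⟩, hts⟩ := sInf_lt_iff.1 hlt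
    refine le_trans ?_ ht
    gcongr
    exact expNeg_le_iff.2 (EReal.coe_lt_coe_iff.1 hts).le
  · intro h
    exact sInf_le ⟨_, h, rfl⟩

/-- The isomorphism `GL_n(K) ≃ GL(V)` given by the basis. -/
def glEquiv (b : Module.Basis (Fin n) K V) :
    GL (Fin n) K ≃* LinearMap.GeneralLinearGroup K V :=
  Units.mapEquiv (Matrix.toLinAlgEquiv b).toMulEquiv

/-- The projection `GL_n(K) → PGL(V)` given by the basis. -/
def Phi (b : Module.Basis (Fin n) K V) : GL (Fin n) K →* PGL K V :=
  (toPGL K V).comp (glEquiv b).toMonoidHom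

theorem Phi_apply (b : Module.Basis (Fin n) K V) (g : GL (Fin n) K) :
    Phi b g = toPGL K V (glEquiv b g) := rfl

theorem Phi_surjective (b : Module.Basis (Fin n) K V) : Function.Surjective (Phi b) :=
  (QuotientGroup.mk'_surjective _).comp (glEquiv b).surjective

theorem coe_glEquiv (b : Module.Basis (Fin n) K V) (g : GL (Fin n) K) :
    (glEquiv b g : Module.End K V) = Matrix.toLinAlgEquiv b g.1 := rfl

theorem eq_iff_glEquiv_apply (b : Module.Basis (Fin n) K V) (g : GL (Fin n) K)
    (N : Matrix (Fin n) (Fin n) K) :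
    g.1 = N ↔ ∀ i, (glEquiv b g : Module.End K V) (b i) = ∑ k, N k i • b k := by
  rw [← (Matrix.toLinAlgEquiv b).injective.eq_iff, coe_glEquiv]
  constructor
  · intro h i
    rw [h, Matrix.toLinAlgEquiv_self]
  · intro h
    refine b.ext fun i => ?_
    rw [h, Matrix.toLinAlgEquiv_self]

/-- The monomial matrix `e_i ↦ t_{w(i)} e_{w(i)}`, as an invertible matrix. -/
def monoUnit (t : Fin n → Kˣ) (w : Equiv.Perm (Fin n)) : GL (Fin n) K where
  val := monoMat t w
  inv := monoMat (fun k => (t (w k))⁻¹) w⁻¹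
  val_inv := by
    ext i j
    rw [mul_apply, Finset.sum_eq_single (w.symm j)]
    · simp only [monoMat, Matrix.one_apply, Equiv.Perm.inv_def, Equiv.apply_symm_apply]
      split_ifs with h
      · subst h; simp
      · simp
    · intro k _ hk; simp [monoMat, hk]
    · simp
  inv_val := by
    ext i j
    rw [mul_apply, Finset.sum_eq_single (w j)]
    · simp only [monoMat, Matrix.one_apply, Equiv.Perm.inv_def, Equiv.symm_apply_apply]
      split_ifs with h
      · subst h; simp
      · simp
    · intro k _ hk; simp [monoMat, hk]
    · simp

theorem coe_monoUnit (t : Fin n → Kˣ) (w : Equiv.Perm (Fin n)) :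
    (monoUnit t w).1 = monoMat t w := rfl

theorem monoUnit_mul (t t' : Fin n → Kˣ) (w w' : Equiv.Perm (Fin n)) :
    monoUnit t w * monoUnit t' w' = monoUnit (fun k => t k * t' (w⁻¹ k)) (w * w') := by
  apply Units.ext
  ext i j
  rw [Units.val_mul, mul_apply, Finset.sum_eq_single (w' j)]
  · simp only [coe_monoUnit, monoMat, Equiv.Perm.mul_apply]
    by_cases h : i = w (w' j)
    · subst h; simp
    · simp [h]
  · intro k _ hk; simp [coe_monoUnit, monoMat, hk]
  · simp

/-- By `h` the monomial matrix pulls `sn d` back to `r` times `sn c`. It conjugates the transvection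
at `(i, j)` into one at `(w i, w j)`, and `r` cancels from the bound. -/
theorem monoUnit_conj_mem {c d : Fin n → ℝ≥0} {t : Fin n → Kˣ} {w : Equiv.Perm (Fin n)} {r : ℝ≥0}
    (h : ∀ i, absK (t (w i) : K) * d (w i) = r * c i) {e : GL (Fin n) K} (he : e ∈ Elem c) :
    monoUnit t w * e * (monoUnit t w)⁻¹ ∈ Elem d := by
  unfold Elem at he
  induction he using Subgroup.closure_induction with
  | mem e he =>
    obtain ⟨i, j, ω, hij, hω, he⟩ := he
    refine mem_Elem_of_eq (i := w i) (j := w j) (ω := t (w i) * ω * (t (w j) : K)⁻¹)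
      (w.injective.ne hij) ?_ ?_
    · have hj : absK (t (w j) : K) ≠ 0 := absK_ne_zero.2 (t (w j)).ne_zero
      rw [map_mul, map_mul, map_inv₀]
      calc _ = (absK (t (w j) : K))⁻¹ * (absK ω * (absK (t (w i) : K) * d (w i))) := by ring
        _ = (absK (t (w j) : K))⁻¹ * (r * (absK ω * c i)) := by rw [h]; ring
        _ ≤ (absK (t (w j) : K))⁻¹ * (r * c j) := by gcongr
        _ = d (w j) := by rw [← h, inv_mul_cancel_left₀ hj]
    · have key : monoMat t w * transvection i j ω =
          transvection (w i) (w j) (t (w i) * ω * (t (w j) : K)⁻¹) * monoMat t w := by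
        refine Matrix.ext_of_mulVec_single fun l => ?_
        ext k
        obtain ⟨k, rfl⟩ := w.surjective k
        rw [← mulVec_mulVec, ← mulVec_mulVec, monoMat_mulVec_apply, transvection_mulVec_apply,
          transvection_mulVec_apply, monoMat_mulVec_apply, monoMat_mulVec_apply]
        simp only [w.injective.eq_iff]
        split_ifs with hk
        · subst hk; field_simp
        · ring
      rw [Units.val_mul, Units.val_mul, he, coe_monoUnit, key, mul_assoc, ← coe_monoUnit,
        ← Units.val_mul, mul_inv_cancel, Units.val_one, mul_one]
  | one => simp
  | mul e f _ _ he hf => simpa [mul_assoc] using mul_mem he hf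
  | inv e _ he => simpa [mul_assoc] using inv_mem he

theorem isMonomial_iff (b : Module.Basis (Fin n) K V) (γ : PGL K V) (t : Fin n → Kˣ)
    (w : Equiv.Perm (Fin n)) : IsMonomial b γ t w ↔ γ = Phi b (monoUnit t w) := by
  have hsum : ∀ i, ∑ k, monoMat t w k i • b k = (t (w i) : K) • b (w i) := by
    intro i
    rw [Finset.sum_eq_single (w i)]
    · simp [monoMat]
    · intro k _ hk; simp [monoMat, hk]
    · simp
  constructor
  · rintro ⟨g', rfl, hg'⟩
    rw [Phi_apply]
    congr 1
    obtain ⟨g, rfl⟩ := (glEquiv b).surjective g'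
    congr 1
    apply Units.ext
    rw [coe_monoUnit, eq_iff_glEquiv_apply b]
    intro i
    rw [hg', hsum]
  · rintro rfl
    refine ⟨glEquiv b (monoUnit t w), rfl, fun i => ?_⟩
    rw [(eq_iff_glEquiv_apply b _ _).1 (coe_monoUnit t w), hsum]

theorem isRootElt_iff (b : Module.Basis (Fin n) K V) {i j : Fin n} (hij : i ≠ j) (ω : K)
    (u : PGL K V) :
    IsRootElt b i j ω u ↔ ∃ g, g.1 = transvection i j ω ∧ Phi b g = u := by
  have hsum : ∀ l, ∑ k, transvection i j ω k l • b k = if l = j then b j + ω • b i else b l := by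
    intro l
    simp only [transvection, Matrix.add_apply, add_smul, Finset.sum_add_distrib, Matrix.one_apply,
      Matrix.single_apply, ite_smul, zero_smul, one_smul, Finset.sum_ite_eq', Finset.mem_univ,
      if_true]
    by_cases hl : l = j
    · subst hl; simp
    · simp [hl, Ne.symm hl]
  constructor
  · rintro ⟨g', rfl, hg'⟩
    obtain ⟨g, rfl⟩ := (glEquiv b).surjective g'
    refine ⟨g, (eq_iff_glEquiv_apply b _ _).2 fun l => ?_, rfl⟩
    rw [hg', hsum]
  · rintro ⟨g, hg, rfl⟩
    refine ⟨glEquiv b g, rfl, fun l => ?_⟩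
    rw [(eq_iff_glEquiv_apply b _ _).1 hg, hsum]

theorem exists_scalar_of_Phi_eq (b : Module.Basis (Fin n) K V) {g h : GL (Fin n) K}
    (e : Phi b g = Phi b h) : ∃ l : Kˣ, g.1 = (l : K) • h.1 := by
  obtain ⟨c, hc, hcs⟩ := exists_eq_mul_center e
  obtain ⟨l, hl⟩ := exists_scalar_of_mem_center b hc
  refine ⟨l, ?_⟩
  change glEquiv b g = glEquiv b h * c at hcs
  apply (Matrix.toLinAlgEquiv b).injective
  rw [map_smul, ← coe_glEquiv, ← coe_glEquiv, hcs]
  ext x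
  simp [hl]

theorem Phi_eq_of_scalar (b : Module.Basis (Fin n) K V) {g h : GL (Fin n) K} {l : K}
    (e : g.1 = l • h.1) : Phi b g = Phi b h := by
  have hk : (h⁻¹ * g).1 = l • (1 : Matrix (Fin n) (Fin n) K) := by
    rw [Units.val_mul, e, Matrix.mul_smul, ← Units.val_mul, inv_mul_cancel, Units.val_one]
  have hc : glEquiv b (h⁻¹ * g) ∈ Subgroup.center (LinearMap.GeneralLinearGroup K V) := by
    rw [Subgroup.mem_center_iff]
    intro k
    obtain ⟨k, rfl⟩ := (glEquiv b).surjective k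
    rw [← map_mul, ← map_mul]
    congr 1
    apply Units.ext
    rw [Units.val_mul k, Units.val_mul (h⁻¹ * g), hk]
    simp
  have h1 : Phi b (h⁻¹ * g) = 1 := (QuotientGroup.eq_one_iff _).2 hc
  rw [map_mul, map_inv, inv_mul_eq_one] at h1
  exact h1.symm

theorem mem_torus_iff (b : Module.Basis (Fin n) K V) (γ : PGL K V) :
    γ ∈ torus b ↔ ∃ d : Fin n → Kˣ, γ = Phi b (monoUnit d 1) := by
  simp only [← isMonomial_iff]
  constructor
  · rintro ⟨g, hg, rfl⟩
    choose d hd using hg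
    exact ⟨d, g, rfl, hd⟩
  · rintro ⟨d, g, rfl, hd⟩
    exact ⟨g, fun i => ⟨d i, hd i⟩, rfl⟩

theorem Phi_monoUnit_mem_normT (b : Module.Basis (Fin n) K V) (t : Fin n → Kˣ)
    (w : Equiv.Perm (Fin n)) : Phi b (monoUnit t w) ∈ normT b := by
  have hcomm : ∀ d : Fin n → Kˣ,
      monoUnit t w * monoUnit d 1 = monoUnit (fun k => d (w⁻¹ k)) 1 * monoUnit t w := by
    intro d
    rw [monoUnit_mul, monoUnit_mul]
    simp [mul_comm]
  refine Subgroup.mem_set_normalizer_iff.2 fun γ => ?_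
  simp only [SetLike.mem_coe, mem_torus_iff]
  constructor
  · rintro ⟨d, rfl⟩
    refine ⟨fun k => d (w⁻¹ k), ?_⟩
    rw [mul_inv_eq_iff_eq_mul, ← map_mul, ← map_mul, hcomm]
  · rintro ⟨d, hd⟩
    refine ⟨fun k => d (w k), ?_⟩
    rw [mul_inv_eq_iff_eq_mul] at hd
    rw [← mul_right_inj (Phi b (monoUnit t w)), hd, ← map_mul, ← map_mul, hcomm]
    simp

theorem exists_monoUnit_of_normT (b : Module.Basis (Fin n) K V) (m : normT b) :
    ∃ t w, m.1 = Phi b (monoUnit t w) := by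
  obtain ⟨t, w, h⟩ := exists_isMonomial b m
  exact ⟨t, w, (isMonomial_iff _ _ _ _).1 h⟩

theorem exists_elem_mul_mul_eq_monoUnit (c d : Fin n → ℝ≥0) (g : GL (Fin n) K) :
    ∃ u ∈ Elem d, ∃ h ∈ Elem c, ∃ t w, u * g * h = monoUnit t w := by
  obtain ⟨u, hu, h, hh, t, w, e⟩ := exists_elem_mul_mul_eq_monoMat c d g
  exact ⟨u, hu, h, hh, t, w, Units.ext e⟩

theorem nuT_eq_mk (t : Fin n → Kˣ) :
    nuT t = Submodule.Quotient.mk fun i => -((val (t i : K) : ℤ) : ℝ) := by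
  have := sum_smul_eta ∅ fun i => -((val (t i : K) : ℤ) : ℝ)
  simpa [nuT] using this

variable [NeZero n]

/-- Translation by `-v(t_j)` in direction `η_j` divides the weight at `j` by `|t_j|`. The factor `s`
reflects the arbitrary representatives in `coord`. -/
theorem exists_coord_affMap (t : Fin n → Kˣ) (w : Equiv.Perm (Fin n)) (x : Abar n) :
    ∃ s : ℝ≥0, s ≠ 0 ∧
      ∀ i, absK (t (w i) : K) * coord (affMap t w x) (w i) = s * coord x i := by
  let f : x.I → ℝ := Quotient.out x.pt
  have hx : x.pt = Submodule.Quotient.mk f := (Quotient.out_eq x.pt).symm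
  let J : Finset (Fin n) := x.I.map w.toEmbedding
  let g : J → ℝ := fun j =>
    f ⟨w.symm j.1, by
        obtain ⟨i, hi, hij⟩ := Finset.mem_map.1 j.2
        simpa [← hij] using hi⟩ + -((val (t j.1 : K) : ℤ) : ℝ)
  have haff : affMap t w x = ofWt (wt J g) := by
    rw [ofWt_wt x.nonempty.map]
    simp only [affMap, nuT_eq_mk]
    congr 1
    rw [hx]
    rfl
  have hwt : ∀ i, absK (t (w i) : K) * wt J g (w i) = coord x i := by
    intro i
    by_cases hi : i ∈ x.I
    · have hi' : w i ∈ J := Finset.mem_map_of_mem _ hi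
      simp only [wt, coord, hi, hi', dif_pos, g, absK_eq_expNeg (t (w i)).ne_zero]
      rw [← expNeg_add]
      congr 1
      simp only [Equiv.symm_apply_apply, f]
      ring
    · have hi' : w i ∉ J := by simpa [J] using hi
      simp [wt, coord, hi, hi']
  have hne : wt J g ≠ 0 := by
    intro h0
    apply coord_ne_zero x
    ext1 i
    rw [← hwt, h0]
    simp
  obtain ⟨s, hs, h⟩ := exists_smul_of_ofWt_eq (coord_ne_zero (affMap t w x)) hne
    ((ofWt_coord _).trans haff)
  refine ⟨s, hs, fun i => ?_⟩
  rw [h, ← hwt i, Pi.smul_apply, smul_eq_mul]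
  ring

/-- The action `ν` is the natural action on seminorm classes; `s` collects the choices of the lift
of `m` and of the weights. -/
theorem exists_sn_nu (b : Module.Basis (Fin n) K V) (m : normT b) (x : Abar n) {g : GL (Fin n) K}
    (hg : Phi b g = m.1) :
    ∃ s : ℝ≥0, s ≠ 0 ∧ ∀ v, sn (coord (nu b m x)) (g.1 *ᵥ v) = s * sn (coord x) v := by
  obtain ⟨t, w, hm⟩ := exists_monoUnit_of_normT b m
  rw [nu_eq b m x t w ((isMonomial_iff _ _ _ _).2 hm)]
  obtain ⟨l, hl⟩ := exists_scalar_of_Phi_eq b (hg.trans hm)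
  obtain ⟨s, hs, h⟩ := exists_coord_affMap t w x
  refine ⟨absK (l : K) * s, mul_ne_zero (absK_ne_zero.2 l.ne_zero) hs, fun v => ?_⟩
  rw [hl, coe_monoUnit, smul_mulVec, sn_scalar, sn_monoMat]
  simp only [h]
  rw [sn_smul, mul_assoc]

theorem eq_of_sn_eq (x y : Abar n) {r : ℝ≥0} (hr : r ≠ 0)
    (h : ∀ v : Fin n → K, sn (coord x) v = r * sn (coord y) v) : x = y := by
  refine eq_of_coord_eq_smul hr ?_
  ext1 i
  have := h (Pi.single i 1)
  rwa [sn_single, sn_single] at this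

theorem Ux_eq_map (b : Module.Basis (Fin n) K V) (x : Abar n) :
    Ux b x = (Elem (coord x)).map (Phi b) := by
  rw [Ux, Elem, MonoidHom.map_closure]
  congr 1
  ext u
  constructor
  · rintro ⟨i, j, ω, hij, hf, hu⟩
    obtain ⟨g, hg, rfl⟩ := (isRootElt_iff b hij ω u).1 hu
    exact ⟨g, ⟨i, j, ω, hij, (fval_le_valE_iff x hij ω).1 hf, hg⟩, rfl⟩
  · rintro ⟨g, ⟨i, j, ω, hij, hf, hg⟩, rfl⟩
    exact ⟨i, j, ω, hij, (fval_le_valE_iff x hij ω).2 hf, (isRootElt_iff b hij ω _).2 ⟨g, hg, rfl⟩⟩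

/-- `P_x` is the stabilizer of the homothety class of the seminorm given by `x`. -/
theorem Phi_mem_Px_iff (b : Module.Basis (Fin n) K V) (x : Abar n) (g : GL (Fin n) K) :
    Phi b g ∈ Px b x ↔
      ∃ r : ℝ≥0, r ≠ 0 ∧ ∀ v, sn (coord x) (g.1 *ᵥ v) = r * sn (coord x) v := by
  constructor
  · rintro ⟨u, hu, m, hm, hg⟩
    rw [Ux_eq_map] at hu
    obtain ⟨e, he, rfl⟩ := hu
    have hk : Phi b (e⁻¹ * g) = m.1 := by rw [map_mul, map_inv, hg, inv_mul_cancel_left]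
    obtain ⟨s, hs, h⟩ := exists_sn_nu b m x hk
    refine ⟨s, hs, fun v => ?_⟩
    have h1 := sn_of_mem_Elem he ((e⁻¹ * g).1 *ᵥ v)
    rw [mulVec_mulVec, ← Units.val_mul, mul_inv_cancel_left] at h1
    rw [h1, ← h, hm]
  · rintro ⟨r, hr, h⟩
    -- The elementary factors are isometries, so the monomial factor also scales the seminorm by `r`
    -- and therefore fixes `x`.
    obtain ⟨u, hu, k, hk, t, w, e⟩ := exists_elem_mul_mul_eq_monoUnit (coord x) (coord x) g
    let m : normT b := ⟨_, Phi_monoUnit_mem_normT b t w⟩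
    have hM : ∀ v, sn (coord x) ((monoUnit t w).1 *ᵥ v) = r * sn (coord x) v := by
      intro v
      rw [← e, Units.val_mul, Units.val_mul, ← mulVec_mulVec, ← mulVec_mulVec, sn_of_mem_Elem hu,
        h, sn_of_mem_Elem hk]
    have hmx : nu b m x = x := by
      obtain ⟨s, hs, hsn⟩ := exists_sn_nu b m x (g := monoUnit t w) rfl
      refine eq_of_sn_eq (K := K) _ _ (div_ne_zero hs hr) fun v => ?_
      have h1 := hM ((monoUnit t w)⁻¹.1 *ᵥ v)
      have h2 := hsn ((monoUnit t w)⁻¹.1 *ᵥ v)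
      rw [mulVec_mulVec, ← Units.val_mul, mul_inv_cancel, Units.val_one, one_mulVec] at h1 h2
      rw [h1, h2]
      field_simp
    -- With `M` the monomial factor, `g = u⁻¹ M k⁻¹ = u⁻¹ (M k⁻¹ M⁻¹) M`, and `M` normalizes the
    -- elementary group because it scales the seminorm.
    refine ⟨Phi b (u⁻¹ * (monoUnit t w * k⁻¹ * (monoUnit t w)⁻¹)), ?_, m, hmx, ?_⟩
    · rw [Ux_eq_map]
      refine Subgroup.mem_map_of_mem _ (mul_mem (inv_mem hu) (monoUnit_conj_mem (r := r) (fun i => ?_)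
        (inv_mem hk)))
      have := hM (Pi.single i 1)
      rw [coe_monoUnit, sn_monoMat, sn_single, sn_single] at this
      exact this
    · change _ = _ * Phi b (monoUnit t w)
      rw [← map_mul, ← e]
      congr 1
      group

end Dictionary

/-! ### The relation as homothety of seminorms, and `U_0^∧` as `GL_n` of the integers -/

section Relation

open Matrix

variable {K : Type*} [Field K] [ValuativeRel K] [TopologicalSpace K] [IsNonarchimedeanLocalField K]
variable {V : Type*} [AddCommGroup V] [Module K V] {n : ℕ} [NeZero n]

theorem inv_mulVec_mulVec (g : GL (Fin n) K) (v : Fin n → K) : g⁻¹.1 *ᵥ (g.1 *ᵥ v) = v := by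
  rw [mulVec_mulVec, ← Units.val_mul, inv_mul_cancel, Units.val_one, one_mulVec]

theorem mulVec_inv_mulVec (g : GL (Fin n) K) (v : Fin n → K) : g.1 *ᵥ (g⁻¹.1 *ᵥ v) = v := by
  rw [mulVec_mulVec, ← Units.val_mul, mul_inv_cancel, Units.val_one, one_mulVec]

/-- Two pairs are equivalent if and only if the seminorms which they define are homothetic. -/
theorem rel_Phi_iff (b : Module.Basis (Fin n) K V) (g h : GL (Fin n) K) (x y : Abar n) :
    Rel b (Phi b g, x) (Phi b h, y) ↔ ∃ r : ℝ≥0, r ≠ 0 ∧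
      ∀ v, sn (coord x) (g⁻¹.1 *ᵥ v) = r * sn (coord y) (h⁻¹.1 *ᵥ v) := by
  constructor
  · rintro ⟨m, hm, hP⟩
    obtain ⟨k, hk⟩ := Phi_surjective b m.1
    change nu b m x = y at hm
    change (Phi b g)⁻¹ * Phi b h * m.1 ∈ Px b x at hP
    rw [← hk, ← map_inv, ← map_mul, ← map_mul, Phi_mem_Px_iff] at hP
    obtain ⟨r, hr, hr'⟩ := hP
    obtain ⟨s, hs, hs'⟩ := exists_sn_nu b m x hk
    rw [hm] at hs'
    refine ⟨r / s, div_ne_zero hr hs, fun v => ?_⟩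
    have h1 := hr' (k⁻¹.1 *ᵥ (h⁻¹.1 *ᵥ v))
    have h2 := hs' (k⁻¹.1 *ᵥ (h⁻¹.1 *ᵥ v))
    rw [Units.val_mul, Units.val_mul, ← mulVec_mulVec, ← mulVec_mulVec, mulVec_inv_mulVec,
      mulVec_inv_mulVec] at h1
    rw [mulVec_inv_mulVec] at h2
    rw [h1, h2]
    field_simp
  · rintro ⟨r, hr, H⟩
    -- Since `h⁻¹ g` carries the class of `x` to that of `y`, so does its monomial factor, which
    -- supplies the element of `N` required by the relation.
    obtain ⟨u, hu, e, he, t, w, E⟩ := exists_elem_mul_mul_eq_monoUnit (coord x) (coord y) (h⁻¹ * g)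
    let m : normT b := ⟨_, Phi_monoUnit_mem_normT b t w⟩
    have hM : ∀ v, sn (coord x) v = r * sn (coord y) ((monoUnit t w).1 *ᵥ v) := by
      intro v
      have h1 := H (g.1 *ᵥ (e.1 *ᵥ v))
      rw [inv_mulVec_mulVec, sn_of_mem_Elem he] at h1
      rw [h1, ← E, mul_assoc, Units.val_mul, ← mulVec_mulVec, sn_of_mem_Elem hu, mul_assoc,
        Units.val_mul, Units.val_mul, ← mulVec_mulVec, ← mulVec_mulVec]
    have hmx : nu b m x = y := by
      obtain ⟨s, hs, hsn⟩ := exists_sn_nu b m x (g := monoUnit t w) rfl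
      refine eq_of_sn_eq (K := K) _ _ (mul_ne_zero hs hr) fun v => ?_
      have h1 := hM ((monoUnit t w)⁻¹.1 *ᵥ v)
      have h2 := hsn ((monoUnit t w)⁻¹.1 *ᵥ v)
      rw [mulVec_inv_mulVec] at h1 h2
      rw [h2, h1, mul_assoc]
    refine ⟨m, hmx, ?_⟩
    change (Phi b g)⁻¹ * Phi b h * Phi b (monoUnit t w) ∈ Px b x
    rw [← map_inv, ← map_mul, ← map_mul, Phi_mem_Px_iff]
    refine ⟨1, one_ne_zero, fun v => ?_⟩
    rw [Units.val_mul, Units.val_mul, ← mulVec_mulVec, ← mulVec_mulVec, H, inv_mulVec_mulVec,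
      hM v, one_mul]

theorem equivalence_rel (b : Module.Basis (Fin n) K V) : Equivalence (Rel b) where
  refl := by
    rintro ⟨γ, x⟩
    obtain ⟨g, rfl⟩ := Phi_surjective b γ
    exact (rel_Phi_iff b _ _ _ _).2 ⟨1, one_ne_zero, fun v => by rw [one_mul]⟩
  symm := by
    rintro ⟨γ, x⟩ ⟨δ, y⟩ h
    obtain ⟨g, rfl⟩ := Phi_surjective b γ
    obtain ⟨k, rfl⟩ := Phi_surjective b δ
    obtain ⟨r, hr, h⟩ := (rel_Phi_iff b _ _ _ _).1 h
    refine (rel_Phi_iff b _ _ _ _).2 ⟨r⁻¹, inv_ne_zero hr, fun v => ?_⟩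
    rw [h, inv_mul_cancel_left₀ hr]
  trans := by
    rintro ⟨γ, x⟩ ⟨δ, y⟩ ⟨ε, z⟩ h h'
    obtain ⟨g, rfl⟩ := Phi_surjective b γ
    obtain ⟨k, rfl⟩ := Phi_surjective b δ
    obtain ⟨l, rfl⟩ := Phi_surjective b ε
    obtain ⟨r, hr, h⟩ := (rel_Phi_iff b _ _ _ _).1 h
    obtain ⟨s, hs, h'⟩ := (rel_Phi_iff b _ _ _ _).1 h'
    refine (rel_Phi_iff b _ _ _ _).2 ⟨r * s, mul_ne_zero hr hs, fun v => ?_⟩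
    rw [h, h', mul_assoc]

/-- The relation is invariant under left multiplication by `G`. -/
theorem Rel.mul_left {b : Module.Basis (Fin n) K V} {p q : PGL K V × Abar n} (h : Rel b p q)
    (γ : PGL K V) : Rel b (γ * p.1, p.2) (γ * q.1, q.2) := by
  obtain ⟨m, hm, hP⟩ := h
  refine ⟨m, hm, ?_⟩
  change (γ * p.1)⁻¹ * (γ * q.1) * m ∈ Px b p.2
  rwa [_root_.mul_inv_rev, mul_assoc p.1⁻¹, inv_mul_cancel_left]

/-- The relation `(g m h, x) ∼ (g, ν(m) x)` for `m ∈ N` and `h ∈ P_x`. -/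
theorem rel_mul_mul (b : Module.Basis (Fin n) K V) (g : PGL K V) (m : normT b) {h : PGL K V}
    {x : Abar n} (hh : h ∈ Px b x) : Rel b (g * m * h, x) (g, nu b m x) := by
  refine ⟨m, rfl, ?_⟩
  change (g * m * h)⁻¹ * g * m ∈ Px b x
  have e : (g * m * h)⁻¹ * g * m = h⁻¹ := by group
  rw [e]
  obtain ⟨k, rfl⟩ := Phi_surjective b h
  obtain ⟨r, hr, H⟩ := (Phi_mem_Px_iff b x k).1 hh
  rw [← map_inv, Phi_mem_Px_iff]
  refine ⟨r⁻¹, inv_ne_zero hr, fun v => ?_⟩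
  have h1 := H (k⁻¹.1 *ᵥ v)
  rw [mulVec_inv_mulVec] at h1
  rw [h1, inv_mul_cancel_left₀ hr]

/-! ### The group `U_0^∧` -/

theorem exists_smul_coord_incl_zero : ∃ r : ℝ≥0, r ≠ 0 ∧ coord (incl (0 : Apt n)) = r • 1 := by
  have h : (incl (0 : Apt n)) = ofWt 1 := by
    have := incl_mk (0 : Fin n → ℝ)
    rw [Submodule.Quotient.mk_zero] at this
    rw [this]
    congr 1
    ext i
    simp [coe_expNeg]
  exact exists_smul_of_ofWt_eq (coord_ne_zero _) one_ne_zero ((ofWt_coord _).trans h)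

theorem Ux_incl_zero (b : Module.Basis (Fin n) K V) : Ux b (incl 0) = (Elem 1).map (Phi b) := by
  obtain ⟨r, hr, h⟩ := exists_smul_coord_incl_zero (n := n)
  rw [Ux_eq_map, h]
  congr 1
  unfold Elem
  congr 1
  ext g
  have hr' : ∀ a : ℝ≥0, a * r ≤ r ↔ a ≤ 1 := fun a => mul_le_iff_le_one_left (pos_iff_ne_zero.2 hr)
  simp [hr']

/-- The stabilizer of the standard norm, i.e. the group `GL_n` of the ring of integers. -/
def stdStab (K : Type*) [Field K] [ValuativeRel K] [TopologicalSpace K]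
    [IsNonarchimedeanLocalField K] (n : ℕ) : Subgroup (GL (Fin n) K) where
  carrier := {g | ∀ v, sn 1 (g.1 *ᵥ v) = sn 1 v}
  one_mem' v := by simp
  mul_mem' {g h} hg hh v := by rw [Units.val_mul, ← mulVec_mulVec, hg, hh]
  inv_mem' {g} hg v := by
    rw [← hg, mulVec_mulVec, ← Units.val_mul, mul_inv_cancel, Units.val_one, one_mulVec]

theorem monoUnit_mem_stdStab_iff {t : Fin n → Kˣ} {w : Equiv.Perm (Fin n)} :
    monoUnit t w ∈ stdStab K n ↔ ∀ i, absK (t i : K) = 1 := by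
  constructor
  · intro h i
    obtain ⟨j, rfl⟩ := w.surjective i
    have := h (Pi.single j 1)
    rw [coe_monoUnit, sn_monoMat, sn_single, sn_single] at this
    simpa using this
  · intro h v
    rw [coe_monoUnit, sn_monoMat]
    simp only [h, one_mul]
    rfl

theorem Elem_one_le_stdStab : Elem 1 ≤ stdStab K n := fun _ hg v => sn_of_mem_Elem hg v

/-- The group of diagonal matrices with entries of absolute value `1`. -/
def unitDiag (K : Type*) [Field K] [ValuativeRel K] [TopologicalSpace K]
    [IsNonarchimedeanLocalField K] (n : ℕ) : Subgroup (GL (Fin n) K) where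
  carrier := {g | ∃ t : Fin n → Kˣ, (∀ i, absK (t i : K) = 1) ∧ g = monoUnit t 1}
  one_mem' := by
    refine ⟨1, fun i => by simp, Units.ext ?_⟩
    ext i j
    by_cases h : i = j <;> simp [coe_monoUnit, monoMat, h]
  mul_mem' := by
    rintro _ _ ⟨t, ht, rfl⟩ ⟨s, hs, rfl⟩
    exact ⟨fun k => t k * s k, fun i => by simp [ht, hs], by rw [monoUnit_mul, one_mul]; rfl⟩
  inv_mem' := by
    rintro _ ⟨t, ht, rfl⟩
    refine ⟨fun i => (t i)⁻¹, fun i => by simp [ht], ?_⟩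
    apply Units.ext
    change monoMat _ _ = _
    rw [inv_one]
    rfl

theorem monoUnit_mem_unitDiag {t : Fin n → Kˣ} (ht : ∀ i, absK (t i : K) = 1) :
    monoUnit t 1 ∈ unitDiag K n := ⟨t, ht, rfl⟩

theorem unitDiag_le_normalizer :
    unitDiag K n ≤ Subgroup.normalizer (Elem 1 : Subgroup (GL (Fin n) K)) := by
  have conj : ∀ d ∈ unitDiag K n, ∀ e ∈ (Elem 1 : Subgroup (GL (Fin n) K)), d * e * d⁻¹ ∈ Elem 1 := by
    rintro _ ⟨t, ht, rfl⟩ e he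
    exact monoUnit_conj_mem (r := 1) (fun i => by simp [ht]) he
  intro d hd
  refine Subgroup.mem_normalizer_iff.2 fun e => ⟨conj d hd e, fun he => ?_⟩
  have := conj d⁻¹ (inv_mem hd) _ he
  simpa [mul_assoc] using this

/-- Up to the sign of one basis vector, a transposition is a product of three integral
transvections. -/
theorem monoUnit_swap_mem {i j : Fin n} (hij : i ≠ j) :
    monoUnit 1 (Equiv.swap i j) ∈ (unitDiag K n ⊔ Elem 1 : Subgroup (GL (Fin n) K)) := by
  let T : ∀ k l : Fin n, k ≠ l → K → GL (Fin n) K := fun k l hkl ω =>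
    shear (Pi.single k ω) (Pi.single l 1) (by simp [hkl.symm])
  have hT : ∀ k l hkl ω, (T k l hkl ω).1 = transvection k l ω := fun k l hkl ω =>
    (transvection_eq_vecMulVec k l ω).symm
  have hmem : ∀ k l hkl ω, absK ω ≤ 1 → T k l hkl ω ∈ Elem 1 := fun k l hkl ω hω =>
    mem_Elem_of_eq hkl (by simpa using hω) (hT k l hkl ω)
  let t : Fin n → Kˣ := fun k => if k = j then -1 else 1
  have ht : ∀ k, absK (t k : K) = 1 := by
    intro k
    simp only [t]
    split_ifs <;> simp [absK_neg]
  have key : monoUnit 1 (Equiv.swap i j) =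
      monoUnit t 1 * (T i j hij 1 * T j i hij.symm (-1) * T i j hij 1) := by
    apply Units.ext
    refine Matrix.ext_of_mulVec_single fun l => ?_
    ext k
    generalize (Pi.single l 1 : Fin n → K) = x
    have h1 : ∀ y : Fin n → K, ((monoUnit t 1).1 *ᵥ y) k = t k * y k := fun y =>
      monoMat_mulVec_apply t 1 y k
    have h2 : ((monoUnit (1 : Fin n → Kˣ) (Equiv.swap i j)).1 *ᵥ x) k = x (Equiv.swap i j k) := by
      have := monoMat_mulVec_apply 1 (Equiv.swap i j) x (Equiv.swap i j k)
      rw [coe_monoUnit]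
      simpa using this
    simp only [Units.val_mul, ← mulVec_mulVec, hT, h1, h2, transvection_mulVec_apply]
    by_cases hi : k = i
    · subst hi
      simp [t, hij, hij.symm]
    · by_cases hj : k = j
      · subst hj
        simp [t, hi]
      · simp [t, hi, hj, Equiv.swap_apply_of_ne_of_ne hi hj]
  rw [key]
  refine mul_mem (Subgroup.mem_sup_left (monoUnit_mem_unitDiag ht)) (Subgroup.mem_sup_right ?_)
  exact mul_mem (mul_mem (hmem i j hij 1 (by simp)) (hmem j i hij.symm (-1) (by simp [absK_neg])))
    (hmem i j hij 1 (by simp))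

theorem monoUnit_one_mem (w : Equiv.Perm (Fin n)) :
    monoUnit 1 w ∈ (unitDiag K n ⊔ Elem 1 : Subgroup (GL (Fin n) K)) := by
  induction w using Equiv.Perm.swap_induction_on with
  | one => exact Subgroup.mem_sup_left (monoUnit_mem_unitDiag fun i => by simp)
  | swap_mul w i j hij ih =>
    have : monoUnit (1 : Fin n → Kˣ) (Equiv.swap i j * w) =
        monoUnit 1 (Equiv.swap i j) * monoUnit 1 w := by
      rw [monoUnit_mul]
      congr 1
      ext; simp
    rw [this]
    exact mul_mem (monoUnit_swap_mem hij) ih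

/-- After elimination with all weights `1`, the monomial factor still preserves the standard norm,
so it is a unit diagonal matrix times a permutation matrix. -/
theorem stdStab_le : stdStab K n ≤ unitDiag K n ⊔ Elem 1 := by
  intro g hg
  obtain ⟨u, hu, h, hh, t, w, e⟩ := exists_elem_mul_mul_eq_monoUnit 1 1 g
  have ht := monoUnit_mem_stdStab_iff.1 (e ▸ mul_mem (mul_mem (Elem_one_le_stdStab hu) hg)
    (Elem_one_le_stdStab hh) : monoUnit t w ∈ stdStab K n)
  have hM : monoUnit t w = monoUnit t 1 * monoUnit 1 w := by
    rw [monoUnit_mul]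
    simp
  have hg' : g = u⁻¹ * monoUnit t w * h⁻¹ := by rw [← e]; group
  rw [hg', hM]
  refine mul_mem (mul_mem (Subgroup.mem_sup_right (inv_mem hu)) (mul_mem ?_ (monoUnit_one_mem w)))
    (Subgroup.mem_sup_right (inv_mem hh))
  exact Subgroup.mem_sup_left (monoUnit_mem_unitDiag ht)

theorem U0hat_eq_image (b : Module.Basis (Fin n) K V) :
    U0hat b = Phi b '' (stdStab K n : Set (GL (Fin n) K)) := by
  ext γ
  constructor
  · rintro ⟨u, hu, z, t, hz, ht, rfl⟩
    rw [Ux_incl_zero] at hu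
    obtain ⟨e, he, rfl⟩ := hu
    rw [isMonomial_iff] at hz
    rw [nuT_eq_mk, Submodule.Quotient.mk_eq_zero, Submodule.mem_span_singleton] at ht
    obtain ⟨k, hk⟩ := ht
    have habs : ∀ i, absK (t i : K) = absK (t 0 : K) := by
      have h1 : ∀ i, (val (t i : K) : ℝ) = -k := by
        intro i
        have := congrFun hk i
        simp at this
        linarith
      intro i
      rw [absK_eq_expNeg (t i).ne_zero, absK_eq_expNeg (t 0).ne_zero, h1, h1]
    -- In `A`, `ν(t) = 0` only says that all `|t_i|` are equal; dividing by the scalar `t_0` gives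
    -- units without changing the class.
    refine ⟨e * monoUnit (fun i => (t 0)⁻¹ * t i) 1, mul_mem (Elem_one_le_stdStab he)
      (monoUnit_mem_stdStab_iff.2 fun i => ?_), ?_⟩
    · rw [Units.val_mul, map_mul, habs, ← map_mul, ← Units.val_mul, inv_mul_cancel, Units.val_one,
        map_one]
    · rw [map_mul, hz]
      congr 1
      refine Phi_eq_of_scalar b (l := ((t 0)⁻¹ : Kˣ)) ?_
      ext i j
      by_cases h : i = j <;> simp [coe_monoUnit, monoMat, h]
  · rintro ⟨g, hg, rfl⟩
    have h1 : g ∈ ((unitDiag K n ⊔ Elem 1 : Subgroup (GL (Fin n) K)) : Set (GL (Fin n) K)) :=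
      stdStab_le hg
    rw [sup_comm, Subgroup.coe_mul_of_right_le_normalizer_left _ _ unitDiag_le_normalizer] at h1
    obtain ⟨e, he, _, ⟨t, ht, rfl⟩, rfl⟩ := h1
    refine ⟨Phi b e, ?_, Phi b (monoUnit t 1), t, (isMonomial_iff _ _ _ _).2 rfl, ?_, map_mul _ _ _⟩
    · rw [Ux_incl_zero]
      exact Subgroup.mem_map_of_mem _ he
    · have h0 : ∀ i, (val (t i : K) : ℝ) = 0 := by
        intro i
        have := ht i
        rw [absK_eq_expNeg (t i).ne_zero] at this
        rw [← neg_log_expNeg (val (t i : K) : ℝ), this]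
        simp
      rw [nuT_eq_mk, Submodule.Quotient.mk_eq_zero]
      simp only [h0, neg_zero]
      exact Submodule.zero_mem _

/-- The decomposition `G = U_0^∧ N P_x`. -/
theorem exists_mul_mul (b : Module.Basis (Fin n) K V) (γ : PGL K V) (x : Abar n) :
    ∃ (v : U0hat b) (m : normT b) (h : PGL K V), h ∈ Px b x ∧ γ = v.1 * m * h := by
  obtain ⟨g, rfl⟩ := Phi_surjective b γ
  -- The weights `1` on the left produce the factor in `U_0^∧`, those of `x` on the right the factor
  -- in `P_x`.
  obtain ⟨u, hu, e, he, t, w, E⟩ := exists_elem_mul_mul_eq_monoUnit (coord x) 1 g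
  refine ⟨⟨Phi b u⁻¹, ?_⟩, ⟨_, Phi_monoUnit_mem_normT b t w⟩, Phi b e⁻¹, ?_, ?_⟩
  · rw [U0hat_eq_image]
    exact ⟨_, Elem_one_le_stdStab (inv_mem hu), rfl⟩
  · rw [Phi_mem_Px_iff]
    exact ⟨1, one_ne_zero, fun v => by rw [sn_of_mem_Elem (inv_mem he), one_mul]⟩
  · change Phi b g = Phi b u⁻¹ * Phi b (monoUnit t w) * Phi b e⁻¹
    rw [← map_mul, ← map_mul, ← E]
    congr 1
    group

end Relation

/-! ### Compactness, the embedding into seminorms, and continuity of the action -/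

section Topology

open Matrix

variable {K : Type*} [Field K] [ValuativeRel K] [TopologicalSpace K] [IsNonarchimedeanLocalField K]
variable {V : Type*} [AddCommGroup V] [Module K V] {n : ℕ}

/-! ### The topology of `PGL(V)` -/

theorem isModuleTopology_matrix : IsModuleTopology K (Matrix (Fin n) (Fin n) K) :=
  inferInstanceAs (IsModuleTopology K (Fin n → Fin n → K))

theorem isQuotientMap_Phi (b : Module.Basis (Fin n) K V) : IsQuotientMap (Phi b) := by
  let _ : TopologicalSpace (Module.End K V) := moduleTopology K (Module.End K V)
  have : IsModuleTopology K (Module.End K V) := ⟨rfl⟩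
  have := isModuleTopology_matrix (K := K) (n := n)
  have : ContinuousAdd (Module.End K V) := IsModuleTopology.toContinuousAdd K _
  have h1 : Continuous (glEquiv b) := Continuous.units_map _
    (IsModuleTopology.continuous_of_linearMap (Matrix.toLinAlgEquiv b).toLinearMap)
  have h2 : Continuous (glEquiv b).symm := Continuous.units_map _
    (IsModuleTopology.continuous_of_linearMap (Matrix.toLinAlgEquiv b).symm.toLinearMap)
  let e : GL (Fin n) K ≃ₜ LinearMap.GeneralLinearGroup K V := ⟨(glEquiv b).toEquiv, h1, h2⟩
  have h3 : IsQuotientMap (toPGL K V) := ⟨⟨rfl⟩, QuotientGroup.mk'_surjective _⟩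
  exact h3.comp e.isQuotientMap

/-- Open quotient maps, unlike general ones, are stable under products, so joint continuity on
products with `PGL(V)` can be tested on matrices. -/
theorem isOpenQuotientMap_Phi (b : Module.Basis (Fin n) K V) : IsOpenQuotientMap (Phi b) :=
  MonoidHom.isOpenQuotientMap_of_isQuotientMap (isQuotientMap_Phi b)

theorem continuousMul_PGL (b : Module.Basis (Fin n) K V) : ContinuousMul (PGL K V) := by
  refine ⟨?_⟩
  rw [← ((isOpenQuotientMap_Phi b).prodMap (isOpenQuotientMap_Phi b)).continuous_comp_iff]
  have h : (fun p : PGL K V × PGL K V => p.1 * p.2) ∘ Prod.map (Phi b) (Phi b) =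
      fun p => Phi b (p.1 * p.2) := by
    ext p
    simp
  rw [h]
  exact (isOpenQuotientMap_Phi b).continuous.comp continuous_mul

variable [NeZero n]

/-- Under the closed embedding `g ↦ (g, g⁻¹)` this is the preimage of the pairs of integral
matrices, a compact set because the ring of integers is compact. -/
theorem isCompact_stdStab : IsCompact (stdStab K n : Set (GL (Fin n) K)) := by
  have hball : IsCompact {x : K | absK x ≤ 1} := by
    have e : {x : K | absK x ≤ 1} = {x : K | ValuativeRel.valuation K x ≤ 1} := by
      ext x
      rw [Set.mem_ofPred_eq, Set.mem_ofPred_eq, ← map_one (absK (K := K)), absK_le_iff, map_one]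
    rw [e]
    exact IsNonarchimedeanLocalField.isCompact_closedBall K 1
  let S : Set (Matrix (Fin n) (Fin n) K) := {A | ∀ i j, absK (A i j) ≤ 1}
  have hS : IsCompact S := by
    have e : S = Set.univ.pi fun _ : Fin n => Set.univ.pi fun _ : Fin n => {x : K | absK x ≤ 1} := by
      ext A
      exact ⟨fun h i _ j _ => h i j, fun h i j => h i trivial j trivial⟩
    rw [e]
    exact isCompact_univ_pi fun _ : Fin n => isCompact_univ_pi fun _ : Fin n => hball
  have hS' : IsCompact (MulOpposite.unop ⁻¹' S) := by
    exact (MulOpposite.opHomeomorph.symm.isCompact_preimage (s := S)).2 hS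
  have hpre : (stdStab K n : Set (GL (Fin n) K)) =
      Units.embedProduct _ ⁻¹' (S ×ˢ (MulOpposite.unop ⁻¹' S)) := by
    have hle : ∀ g : GL (Fin n) K, g ∈ stdStab K n → g.1 ∈ S := by
      intro g hg i j
      have h1 := le_sn 1 (g.1 *ᵥ Pi.single j 1) i
      rw [hg, sn_single, mulVec_single_one] at h1
      simpa using h1
    have hge : ∀ (A : Matrix (Fin n) (Fin n) K), A ∈ S → ∀ v, sn 1 (A *ᵥ v) ≤ sn 1 v := by
      intro A hA v
      refine sn_le_iff.2 fun i => ?_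
      rw [Pi.one_apply, mul_one]
      rw [mulVec, dotProduct]
      refine (absK_sum_le _ _).trans (Finset.sup_le fun j _ => ?_)
      rw [map_mul]
      calc _ ≤ 1 * absK (v j) := by gcongr; exact hA i j
        _ = absK (v j) * (1 : Fin n → ℝ≥0) j := by simp
        _ ≤ _ := le_sn _ _ _
    ext g
    constructor
    · intro hg
      exact ⟨hle g hg, hle g⁻¹ (inv_mem hg)⟩
    · rintro ⟨h1, h2⟩ v
      refine le_antisymm (hge _ h1 v) ?_
      have := hge _ h2 (g.1 *ᵥ v)
      change sn 1 (g⁻¹.1 *ᵥ (g.1 *ᵥ v)) ≤ _ at this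
      rwa [inv_mulVec_mulVec] at this
  rw [hpre]
  exact Units.isClosedEmbedding_embedProduct.isCompact_preimage (hS.prod hS')

theorem compactSpace_U0hat (b : Module.Basis (Fin n) K V) : CompactSpace (U0hat b) := by
  rw [← isCompact_iff_compactSpace, U0hat_eq_image]
  exact isCompact_stdStab.image (isOpenQuotientMap_Phi b).continuous

theorem one_mem_U0hat (b : Module.Basis (Fin n) K V) : (1 : PGL K V) ∈ U0hat b := by
  rw [U0hat_eq_image]
  exact ⟨1, one_mem _, map_one _⟩

/-! ### Normalized seminorms -/

/-- The function `f`, divided by its maximum on the standard basis. -/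
def normFn (f : (Fin n → K) → ℝ≥0) (v : Fin n → K) : ℝ≥0 :=
  f v / Finset.univ.sup fun i => f (Pi.single i 1)

theorem normFn_mul {r : ℝ≥0} (hr : r ≠ 0) (f : (Fin n → K) → ℝ≥0) :
    normFn (fun v => r * f v) = normFn f := by
  ext1 v
  simp only [normFn]
  rw [← NNReal.mul_finset_sup, mul_div_mul_left _ _ hr]

/-- The image under `g` of the seminorm given by `x`. -/
def translate (g : GL (Fin n) K) (x : Abar n) (v : Fin n → K) : ℝ≥0 := sn (nc x) (g⁻¹.1 *ᵥ v)

/-- Otherwise the row of `g⁻¹` at an index of non-zero weight would vanish. This justifies the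
division in `normFn`. -/
theorem sup_translate_ne_zero (g : GL (Fin n) K) (x : Abar n) :
    (Finset.univ.sup fun i => translate g x (Pi.single i 1)) ≠ 0 := by
  intro h
  obtain ⟨k, hk⟩ := Function.ne_iff.1 (nc_ne_zero x)
  have h1 : ∀ i, g⁻¹.1 k i = 0 := by
    intro i
    have h2 : absK (g⁻¹.1 k i) * nc x k ≤ 0 := by
      rw [← h]
      refine le_trans ?_ (Finset.le_sup (f := fun i => translate g x (Pi.single i 1))
        (Finset.mem_univ i))
      refine le_trans (le_of_eq ?_) (le_sn _ _ k)
      rw [mulVec_single_one]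
      rfl
    have h3 := mul_eq_zero.1 (le_antisymm h2 zero_le)
    exact (map_eq_zero _).1 (h3.resolve_right hk)
  have h4 : (g⁻¹.1 * g.1) k k = 0 := by
    rw [mul_apply]
    exact Finset.sum_eq_zero fun i _ => by rw [h1, zero_mul]
  rw [← Units.val_mul, inv_mul_cancel, Units.val_one, one_apply_eq] at h4
  exact one_ne_zero h4

theorem normFn_translate_eq_iff (b : Module.Basis (Fin n) K V) (g h : GL (Fin n) K)
    (x y : Abar n) : normFn (translate g x) = normFn (translate h y) ↔
      Rel b (Phi b g, x) (Phi b h, y) := by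
  have hsn : ∀ x : Abar n, ∃ r : ℝ≥0, r ≠ 0 ∧ ∀ v : Fin n → K, sn (nc x) v = r * sn (coord x) v := by
    intro x
    obtain ⟨r, hr, h⟩ := exists_nc_eq x
    exact ⟨r, hr, fun v => by rw [h, ← sn_smul]; rfl⟩
  obtain ⟨r, hr, hx⟩ := hsn x
  obtain ⟨s, hs, hy⟩ := hsn y
  rw [rel_Phi_iff]
  constructor
  · intro H
    refine ⟨r⁻¹ * ((Finset.univ.sup fun i => translate g x (Pi.single i 1)) *
      ((Finset.univ.sup fun i => translate h y (Pi.single i 1))⁻¹ * s)), ?_, fun v => ?_⟩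
    · exact mul_ne_zero (inv_ne_zero hr) (mul_ne_zero (sup_translate_ne_zero g x)
        (mul_ne_zero (inv_ne_zero (sup_translate_ne_zero h y)) hs))
    · have h1 := congrFun H v
      simp only [normFn] at h1
      rw [div_eq_iff (sup_translate_ne_zero g x)] at h1
      rw [translate, translate, hx, hy] at h1
      rw [← mul_right_inj' hr, h1]
      field_simp
  · rintro ⟨q, hq, H⟩
    have : translate g x = fun v => (r * q / s) * translate h y v := by
      ext1 v
      rw [translate, translate, hx, hy, H]
      field_simp
    rw [this, normFn_mul (div_ne_zero (mul_ne_zero hr hq) hs)]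

/-- `translate` is built from `nc` for this purpose: `coord` depends on an arbitrary choice of
representative. -/
theorem continuous_normFn_translate :
    Continuous fun p : GL (Fin n) K × Abar n => normFn (translate p.1 p.2) := by
  have h : ∀ v : Fin n → K, Continuous fun p : GL (Fin n) K × Abar n => translate p.1 p.2 v := by
    intro v
    have h1 : Continuous fun p : GL (Fin n) K × Abar n => p.1⁻¹.1 *ᵥ v :=
      (Units.continuous_val.comp (continuous_inv.comp continuous_fst)).matrix_mulVec
        continuous_const
    have h2 : Continuous fun p : GL (Fin n) K × Abar n => nc p.2 := continuous_nc.comp continuous_snd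
    have h3 : Continuous fun p : GL (Fin n) K × Abar n => (nc p.2, p.1⁻¹.1 *ᵥ v) := h2.prodMk h1
    simpa only [Function.comp_def, translate] using continuous_sn.comp h3
  refine continuous_pi fun v => ?_
  have h2 : Continuous fun p : GL (Fin n) K × Abar n =>
      Finset.univ.sup fun i => translate p.1 p.2 (Pi.single i 1) :=
    continuous_sup.comp (continuous_pi fun i : Fin n => h (Pi.single i 1))
  exact (h v).div₀ h2 fun p => sup_translate_ne_zero p.1 p.2

/-- The normalized seminorm given by a pair in `G × A̅`. -/
def sem (b : Module.Basis (Fin n) K V) (γ : PGL K V) (x : Abar n) : (Fin n → K) → ℝ≥0 :=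
  normFn (translate (Function.surjInv (Phi_surjective b) γ) x)

theorem sem_Phi (b : Module.Basis (Fin n) K V) (g : GL (Fin n) K) (x : Abar n) :
    sem b (Phi b g) x = normFn (translate g x) := by
  rw [sem, normFn_translate_eq_iff b, Function.surjInv_eq (Phi_surjective b)]
  exact (equivalence_rel b).refl _

theorem sem_eq_iff (b : Module.Basis (Fin n) K V) (γ δ : PGL K V) (x y : Abar n) :
    sem b γ x = sem b δ y ↔ Rel b (γ, x) (δ, y) := by
  obtain ⟨g, rfl⟩ := Phi_surjective b γ
  obtain ⟨h, rfl⟩ := Phi_surjective b δ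
  rw [sem_Phi, sem_Phi, normFn_translate_eq_iff b]

/-- The lift chosen in `sem` need not be continuous, but by `sem_Phi` it does not affect the value,
so continuity descends from matrices. -/
theorem continuous_sem (b : Module.Basis (Fin n) K V) :
    Continuous fun p : PGL K V × Abar n => sem b p.1 p.2 := by
  rw [← ((isOpenQuotientMap_Phi b).prodMap IsOpenQuotientMap.id).continuous_comp_iff]
  have h : (fun p : PGL K V × Abar n => sem b p.1 p.2) ∘ Prod.map (Phi b) id =
      fun p => normFn (translate p.1 p.2) := by
    ext1 p
    exact sem_Phi b p.1 p.2
  rw [h]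
  exact continuous_normFn_translate

/-! ### The compactified building as a space of seminorms -/

/-- The normalized seminorm given by a point of the compactified building. -/
def semX (b : Module.Basis (Fin n) K V) : Xbar b → (Fin n → K) → ℝ≥0 :=
  Quot.lift (fun p => sem b p.1.1 p.2) fun _ _ h => (sem_eq_iff b _ _ _ _).2 h

theorem semX_toXbar (b : Module.Basis (Fin n) K V) (u : U0hat b) (x : Abar n) :
    semX b (toXbar b u x) = sem b u.1 x := rfl

theorem exists_toXbar_eq (b : Module.Basis (Fin n) K V) (z : Xbar b) :
    ∃ u x, toXbar b u x = z := by
  induction z using Quot.ind with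
  | mk p => exact ⟨p.1, p.2, rfl⟩

theorem semX_injective (b : Module.Basis (Fin n) K V) : Function.Injective (semX b) := by
  intro z z' h
  obtain ⟨u, x, rfl⟩ := exists_toXbar_eq b z
  obtain ⟨v, y, rfl⟩ := exists_toXbar_eq b z'
  exact Quot.sound ((sem_eq_iff b _ _ _ _).1 h)

theorem continuous_semX (b : Module.Basis (Fin n) K V) : Continuous (semX b) :=
  have h : Continuous fun p : U0hat b × Abar n => (p.1.1, p.2) := by fun_prop
  have h' : Continuous fun p : U0hat b × Abar n => sem b p.1.1 p.2 := by
    simpa only [Function.comp_def] using (continuous_sem b).comp h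
  continuous_quot_lift _ h'

theorem isClosedEmbedding_semX (b : Module.Basis (Fin n) K V) : IsClosedEmbedding (semX b) := by
  have := compactSpace_U0hat b
  exact (continuous_semX b).isClosedEmbedding (semX_injective b)

theorem sem_mul_eq {b : Module.Basis (Fin n) K V} {δ ε : PGL K V} {x y : Abar n}
    (h : sem b δ x = sem b ε y) (γ : PGL K V) : sem b (γ * δ) x = sem b (γ * ε) y := by
  rw [sem_eq_iff] at h ⊢
  exact h.mul_left γ

theorem sem_mul_mul (b : Module.Basis (Fin n) K V) (g : PGL K V) (m : normT b) {h : PGL K V}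
    {x : Abar n} (hh : h ∈ Px b x) : sem b (g * m * h) x = sem b g (nu b m x) :=
  (sem_eq_iff _ _ _ _ _).2 (rel_mul_mul b g m hh)

/-- The right-hand side involves no decomposition of `g u`. Every admissible choice yields this
seminorm because `(v m h, x) ∼ (v, ν(m) x)`, and `semX` is injective, so `μ` is well defined. -/
theorem muGraph_toXbar_iff (b : Module.Basis (Fin n) K V) (g : PGL K V) (u : U0hat b) (x : Abar n)
    (z : Xbar b) : MuGraph b g (toXbar b u x) z ↔ semX b z = sem b (g * u.1) x := by
  constructor
  · rintro ⟨u', x', v, m, h, hh, e, hz, rfl⟩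
    have h1 : sem b u.1 x = sem b u'.1 x' := congrArg (semX b) hz
    rw [sem_mul_eq h1, e, sem_mul_mul b v.1 m hh, semX_toXbar]
  · intro hz
    obtain ⟨v, m, h, hh, e⟩ := exists_mul_mul b (g * u.1) x
    refine ⟨u, x, v, m, h, hh, e, rfl, semX_injective b ?_⟩
    rw [hz, e, sem_mul_mul b v.1 m hh, semX_toXbar]

theorem mu_eq_iff (b : Module.Basis (Fin n) K V) (g : PGL K V) (z z' : Xbar b) :
    mu b g z = z' ↔ MuGraph b g z z' := by
  obtain ⟨u, x, rfl⟩ := exists_toXbar_eq b z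
  have hex : ∃ z', MuGraph b g (toXbar b u x) z' := by
    obtain ⟨v, m, h, hh, e⟩ := exists_mul_mul b (g * u.1) x
    exact ⟨_, u, x, v, m, h, hh, e, rfl, rfl⟩
  have hmu : MuGraph b g (toXbar b u x) (mu b g (toXbar b u x)) := by
    rw [mu, dif_pos hex]
    exact hex.choose_spec
  rw [muGraph_toXbar_iff] at hmu ⊢
  rw [← hmu, (semX_injective b).eq_iff, eq_comm]

theorem semX_mu (b : Module.Basis (Fin n) K V) (g : PGL K V) (u : U0hat b) (x : Abar n) :
    semX b (mu b g (toXbar b u x)) = sem b (g * u.1) x :=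
  (muGraph_toXbar_iff b g u x _).1 ((mu_eq_iff b g _ _).1 rfl)

theorem mu_one (b : Module.Basis (Fin n) K V) (z : Xbar b) : mu b 1 z = z := by
  obtain ⟨u, x, rfl⟩ := exists_toXbar_eq b z
  exact semX_injective b (by rw [semX_mu, one_mul, semX_toXbar])

theorem mu_mul (b : Module.Basis (Fin n) K V) (g h : PGL K V) (z : Xbar b) :
    mu b (g * h) z = mu b g (mu b h z) := by
  obtain ⟨u, x, rfl⟩ := exists_toXbar_eq b z
  obtain ⟨v, y, hv⟩ := exists_toXbar_eq b (mu b h (toXbar b u x))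
  have h1 : sem b v.1 y = sem b (h * u.1) x := by rw [← semX_mu, ← hv, semX_toXbar]
  apply semX_injective b
  rw [← hv, semX_mu, semX_mu, sem_mul_eq h1, mul_assoc]

theorem continuous_mu (b : Module.Basis (Fin n) K V) :
    Continuous fun p : PGL K V × Xbar b => mu b p.1 p.2 := by
  have := compactSpace_U0hat b
  have := continuousMul_PGL b
  have : T2Space (Xbar b) := (isClosedEmbedding_semX b).toIsEmbedding.t2Space
  let π : U0hat b × Abar n → Xbar b := fun p => toXbar b p.1 p.2
  have hπ : Continuous π := continuous_quot_mk
  have hsurj : Function.Surjective π := fun z => by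
    obtain ⟨u, x, rfl⟩ := exists_toXbar_eq b z
    exact ⟨(u, x), rfl⟩
  -- A product of a quotient map with an identity need not be a quotient map. Here `π` goes from a
  -- compact to a Hausdorff space, so it is proper, and properness survives the product.
  have hprop : IsProperMap (Prod.map (id : PGL K V → PGL K V) π) :=
    IsProperMap.prodMap isProperMap_id hπ.isProperMap
  have hquot : IsQuotientMap (Prod.map (id : PGL K V → PGL K V) π) :=
    hprop.isClosedMap.isQuotientMap hprop.continuous (Function.surjective_id.prodMap hsurj)
  rw [(isClosedEmbedding_semX b).toIsEmbedding.continuous_iff, hquot.continuous_iff]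
  have h : (semX b ∘ fun p : PGL K V × Xbar b => mu b p.1 p.2) ∘ Prod.map id π =
      fun p : PGL K V × (U0hat b × Abar n) => sem b (p.1 * p.2.1.1) p.2.2 := by
    ext1 p
    exact semX_mu b p.1 p.2.1 p.2.2
  rw [h]
  have h2 : Continuous fun p : PGL K V × (U0hat b × Abar n) => (p.1 * p.2.1.1, p.2.2) := by
    fun_prop
  simpa only [Function.comp_def] using (continuous_sem b).comp h2

/-- The homeomorphism of `X̅` with the quotient of `G × A̅`. -/
def xbarHomeo (b : Module.Basis (Fin n) K V) : Xbar b ≃ₜ Quot (Rel b) where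
  toFun := Quot.lift (fun p => Quot.mk _ (p.1.1, p.2)) fun _ _ h => Quot.sound h
  -- The point `μ(γ, [1, x])` has the seminorm of `(γ, x)`, so it represents that class by a pair
  -- with first entry in `U_0^∧`.
  invFun := Quot.lift (fun p => mu b p.1 (toXbar b ⟨1, one_mem_U0hat b⟩ p.2)) fun p q h =>
    semX_injective b (by
      rw [semX_mu, semX_mu, mul_one, mul_one]
      exact (sem_eq_iff b _ _ _ _).2 h)
  left_inv z := by
    obtain ⟨u, x, rfl⟩ := exists_toXbar_eq b z
    apply semX_injective b
    refine (semX_mu b _ _ _).trans ?_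
    rw [mul_one, semX_toXbar]
  right_inv z := by
    induction z using Quot.ind with
    | mk p =>
      obtain ⟨γ, x⟩ := p
      obtain ⟨v, y, hv⟩ := exists_toXbar_eq b (mu b γ (toXbar b ⟨1, one_mem_U0hat b⟩ x))
      change Quot.lift _ _ (mu b γ (toXbar b ⟨1, one_mem_U0hat b⟩ x)) = _
      rw [← hv]
      refine Quot.sound ((sem_eq_iff b _ _ _ _).1 ?_)
      rw [← semX_toXbar, hv, semX_mu, mul_one]
  continuous_toFun := continuous_quot_lift _ (continuous_quot_mk.comp
    ((continuous_subtype_val.comp continuous_fst).prodMk continuous_snd))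
  continuous_invFun := continuous_quot_lift _ ((continuous_mu b).comp
    (continuous_fst.prodMk (continuous_quot_mk.comp (continuous_const.prodMk continuous_snd))))

end Topology

end

end BTCompact

theorem theorem4p2 {K : Type*} [Field K] [ValuativeRel K] [TopologicalSpace K]
    [IsNonarchimedeanLocalField K] {V : Type*} [AddCommGroup V] [Module K V] {n : ℕ} [NeZero n]
    (b : Module.Basis (Fin n) K V) :
    -- `∼` is an equivalence relation on `G × A̅`
    Equivalence (BTCompact.Rel b) ∧
    -- `μ` is well defined by its defining property, and it is an action of `G`
    (∀ g z z', BTCompact.mu b g z = z' ↔ BTCompact.MuGraph b g z z') ∧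
    (∀ z, BTCompact.mu b 1 z = z) ∧
    (∀ g h z, BTCompact.mu b (g * h) z = BTCompact.mu b g (BTCompact.mu b h z)) ∧
    -- `μ` is continuous
    Continuous (fun p : BTCompact.PGL K V × BTCompact.Xbar b => BTCompact.mu b p.1 p.2) ∧
    -- the inclusion `U_0^∧ × A̅ ⊆ G × A̅` induces a homeomorphism of `X̅` onto `(G × A̅) / ∼`
    ∃ τ : BTCompact.Xbar b ≃ₜ Quot (BTCompact.Rel b),
      ∀ u x, τ (BTCompact.toXbar b u x) = Quot.mk _ (u.1, x) :=
  ⟨BTCompact.equivalence_rel b, BTCompact.mu_eq_iff b, BTCompact.mu_one b, BTCompact.mu_mul b,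
    BTCompact.continuous_mu b, BTCompact.xbarHomeo b, fun _ _ => rfl⟩
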